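/- Let $H$ be a real Hilbert space and let $W=(W(h))_{h\in H}$ be an isonormal process on a probability space $(\Omega,\mathcal F,\mathbf P)$, that is, a centered Gaussian family with $\mathbf E[W(h)W(g)]=\langle h,g\rangle_H$ for all $h,g\in H$. For a simple random variable $F=f(W(h_1),\dots,W(h_n))$, with $h_i\in H$ and $f\in C^\infty(\mathbb R^n)$ having all partial derivatives of at most polynomial growth, put $\mathrm DF=\sum_{i=1}^n\frac{\partial f}{\partial x_i}(W(h_1),\dots,W(h_n))\,h_i$; the Malliavin derivative $\mathrm D$ is the closure of this operator from $L^2(\Omega)$ to $L^2(\Omega;H)$, and $\mathbb D^{1,2}\subset L^2(\Omega)$ is its domain. The Skorohod integral $\delta$ is the adjoint of $\mathrm D$: for $v\in\mathrm{Dom}(\delta)\subset L^2(\Omega;H)$, $\delta(v)$ is the square-integrable, $\sigma(W)$-measurable random variable with $\mathbf E[\delta(v)F]=\mathbf E[\langle v,\mathrm DF\rangle_H]$ for every $F\in\mathbb D^{1,2}$. For random vectors $\mathbf U,\mathbf V$ in $\mathbb R\times\mathbb R^d$ with finite first moments, put $$d_{\mathrm W}(\mathcal L(\mathbf U),\mathcal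 L(\mathbf V))=\sup_h\big|\mathbf E[h(\mathbf U)]-\mathbf E[h(\mathbf V)]\big|,$$ the supremum being over all $h:\mathbb R\times\mathbb R^d\to\mathbb R$ that are Lipschitz with constant at most $1$ for the Euclidean norm of $\mathbb R^{d+1}$. **Proposition.** For every $\sigma\ge 0$ there is a constant $C>0$, depending only on $\sigma$, such that the following holds. Let $X=\delta(v)$ with $v\in\mathrm{Dom}(\delta)$, suppose that $X\in\mathbb D^{1,2}$ and $\mathbf E[X^2]=\sigma^2$, and let $\mathbb Y=(Y_1,\dots,Y_d)$ be a random vector with $Y_j\in\mathbb D^{1,2}$ for each $j=1,\dots,d$. Then $$d_{\mathrm W}\big(\mathcal L(X,\mathbb Y),\,\mathcal N(0,\sigma^2)\otimes\mathcal L(\mathbb Y)\big)\le C\left\{\sqrt{\mathrm{Var}\big[\langle \mathrm DX,v\rangle_H\big]}+\sum_{j=1}^d\sqrt{\mathbf E\big[\langle v,\mathrm DY_j\rangle_H^2\big]}\right\},$$ where the right-hand side is $+\infty$ if one of the variances or second moments in it is infinite. -/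

import Mathlib

open MeasureTheory ProbabilityTheory Filter Topology
open scoped ENNReal NNReal RealInnerProductSpace

noncomputable section

namespace SteinMalliavin

/-! ### Wasserstein distance on `ℝ × ℝ^d` -/

/-- `h : ℝ × ℝ^d → ℝ` is Lipschitz with constant at most `1` for the Euclidean norm
of `ℝ^{d+1}`, that is `|(x, y)|² = x² + |y|²`. -/
def LipOne {d : ℕ} (h : ℝ × EuclideanSpace ℝ (Fin d) → ℝ) : Prop :=
  ∀ p q : ℝ × EuclideanSpace ℝ (Fin d),
    |h p - h q| ≤ Real.sqrt ((p.1 - q.1) ^ 2 + ‖p.2 - q.2‖ ^ 2)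

open Classical in
/-- The Wasserstein distance `sup_{h ∈ Lip(1)} |∫ h dμ - ∫ h dν|` between two laws on
`ℝ × ℝ^d`. It is meant for laws which integrate all functions of `Lip(1)`; if one of them does
not, the value is set to `∞`, so that no integral of a non-integrable function ever enters. -/
def wassersteinDist {d : ℕ} (μ ν : Measure (ℝ × EuclideanSpace ℝ (Fin d))) : ℝ≥0∞ :=
  ⨆ (h : ℝ × EuclideanSpace ℝ (Fin d) → ℝ) (_ : LipOne h),
    if Integrable h μ ∧ Integrable h ν then ENNReal.ofReal |∫ p, h p ∂μ - ∫ p, h p ∂ν| else ∞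

/-! ### Malliavin calculus of an isonormal process -/

variable {Ω : Type*} [MeasurableSpace Ω] {H : Type*} [NormedAddCommGroup H]
  [InnerProductSpace ℝ H]

/-- An isonormal process over `H`: a centered Gaussian family `(W h)_{h ∈ H}` with
`E[W(h) W(g)] = ⟨h, g⟩`. -/
structure IsIsonormal (W : H → Ω → ℝ) (P : Measure Ω) : Prop where
  measurable : ∀ h, Measurable (W h)
  gaussian : IsGaussianProcess W P
  centered : ∀ h, ∫ ω, W h ω ∂P = 0
  covariance : ∀ h g, ∫ ω, W h ω * W g ω ∂P = ⟪h, g⟫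

/-- `F = f(W(h₁), …, W(hₙ))` is a simple random variable, where `f` is smooth and all its
derivatives have at most polynomial growth, and
`DF = ∑ᵢ ∂ᵢf(W(h₁), …, W(hₙ)) hᵢ`. -/
def IsSimple (W : H → Ω → ℝ) (F : Ω → ℝ) (DF : Ω → H) : Prop :=
  ∃ (n : ℕ) (f : EuclideanSpace ℝ (Fin n) → ℝ) (h : Fin n → H),
    Function.HasTemperateGrowth f ∧
    (∀ ω, F ω = f (WithLp.toLp 2 fun i => W (h i) ω)) ∧
    ∀ ω, DF ω = ∑ i, (fderiv ℝ f (WithLp.toLp 2 fun j => W (h j) ω)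
      (EuclideanSpace.single i 1)) • h i

/-- `F ∈ 𝔻^{1,2}` with Malliavin derivative `DF` (an element of `L²(Ω; H)`): the pair `(F, DF)`
is the limit in `L²(Ω) × L²(Ω; H)` of pairs `(Fₙ, DFₙ)` with `Fₙ` simple. So this is the graph of
the closure of the derivative operator on simple random variables. -/
structure HasMalliavinDeriv (W : H → Ω → ℝ) (P : Measure Ω) (F : Ω → ℝ) (DF : Ω → H) :
    Prop where
  memLp : MemLp F 2 P
  memLp_deriv : MemLp DF 2 P
  exists_approx : ∃ (Fn : ℕ → Ω → ℝ) (DFn : ℕ → Ω → H),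
    (∀ n, IsSimple W (Fn n) (DFn n)) ∧
    Tendsto (fun n => eLpNorm (Fn n - F) 2 P) atTop (𝓝 0) ∧
    Tendsto (fun n => eLpNorm (DFn n - DF) 2 P) atTop (𝓝 0)

/-- The σ-algebra generated by the process. -/
@[reducible] def noiseSigma (W : H → Ω → ℝ) : MeasurableSpace Ω :=
  ⨆ h, MeasurableSpace.comap (W h) inferInstance

/-- `v ∈ Dom δ ⊂ L²(Ω; H)` and `X = δ(v)`: the Skorohod integral `X` is the square-integrable
functional of the process with `E[X F] = E[⟨v, DF⟩]` for all `F ∈ 𝔻^{1,2}`. As `𝔻^{1,2}` is dense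
in the square-integrable functionals of the process, `X` is unique up to null sets. The ambient
σ-algebra may be larger than the one generated by the process. -/
structure IsSkorohodIntegral (W : H → Ω → ℝ) (P : Measure Ω) (v : Ω → H) (X : Ω → ℝ) :
    Prop where
  memLp_integrand : MemLp v 2 P
  memLp : MemLp X 2 P
  measurable_noise : AEStronglyMeasurable[noiseSigma W] X P
  duality : ∀ (F : Ω → ℝ) (DF : Ω → H), HasMalliavinDeriv W P F DF →
    ∫ ω, X ω * F ω ∂P = ∫ ω, ⟪v ω, DF ω⟫ ∂P

end SteinMalliavin

end

/-! Let `N` be centered Gaussian with variance `σ²`, independent of `(X, Y)`, and let `h` be `C¹`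
and 1-Lipschitz. The expectation of `h(sin θ X + cos θ N, Y)` passes from `(N, Y)` at `θ = 0` to
`(X, Y)` at `θ = π/2`, so it suffices to bound its derivative `E[∂₁h (cos θ X - sin θ N)]` uniformly
in `θ`.

Integrating out `N` gives `g(x, y) = E[∂₁h(sin θ x + cos θ N, y)]`. The term with `X` is `cos θ E[X
g(X, Y)]`, which Skorohod duality and the chain rule turn into `cos θ E[∂ₓg ⟨v, DX⟩ + ∑ⱼ ∂ⱼg ⟨v,
DYⱼ⟩]`. Gaussian integration by parts turns the term with `N` into `cos θ σ² E[∂ₓg]`. The difference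
contains only `⟨v, DX⟩ - σ²` and `⟨v, DYⱼ⟩`.

The same integration by parts gives `cos θ σ² ∂ₐg = E[N ∂h]`, where `∂h` is a first derivative of
`h`. Hence `|cos θ ∂ₐg| ≤ E|N| / σ²`: no second derivative of `h` is needed, and the singularity at
`cos θ = 0` cancels. Integration over `[0, π/2]` gives an `L¹` bound. Since `E⟨DX, v⟩ = E[X²] = σ²`
by duality, Cauchy–Schwarz then yields the variance and the second moments.

The main steps are `IsSkorohodIntegral.chainDuality`, `exists_gaussian_smoothing`,
`abs_integral_sub_integral_gaussian_le`, and mollification of the test function in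
`LipOne.exists_contDiff_approx`. If `σ = 0`, then `X = 0` almost surely and both laws coincide. -/

namespace SteinMalliavin

/-! ### Simple random variables and their chain rule -/

section Simple

variable {Ω : Type*} [MeasurableSpace Ω] {H : Type*} [NormedAddCommGroup H]
  [InnerProductSpace ℝ H] {W : H → Ω → ℝ}

theorem IsSimple.measurable (hW : ∀ h, Measurable (W h)) {F : Ω → ℝ} {DF : Ω → H}
    (hF : IsSimple W F DF) : Measurable F := by
  obtain ⟨n, f, h, hf, hF, -⟩ := hF
  have : F = fun ω => f (WithLp.toLp 2 fun i => W (h i) ω) := funext hF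
  rw [this]
  refine hf.1.continuous.measurable.comp ?_
  exact (PiLp.continuous_toLp 2 _).measurable.comp (measurable_pi_lambda _ fun i => hW (h i))

theorem IsSimple.stronglyMeasurable_deriv (hW : ∀ h, Measurable (W h)) {F : Ω → ℝ} {DF : Ω → H}
    (hF : IsSimple W F DF) : StronglyMeasurable DF := by
  obtain ⟨n, f, h, hf, -, hDF⟩ := hF
  rw [funext hDF]
  refine Finset.stronglyMeasurable_fun_sum _ fun i _ => ?_
  refine StronglyMeasurable.smul_const (Measurable.stronglyMeasurable ?_) _
  have hc : Continuous fun x => fderiv ℝ f x (EuclideanSpace.single i 1) :=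
    (hf.1.continuous_fderiv (by simp)).clm_apply continuous_const
  refine hc.measurable.comp ?_
  exact (PiLp.continuous_toLp 2 _).measurable.comp (measurable_pi_lambda _ fun i => hW (h i))

omit [MeasurableSpace Ω] in
/-- The chain rule for simple random variables. -/
theorem IsSimple.comp_sum_smul {ι : Type*} [Fintype ι] {V : Type*} [NormedAddCommGroup V]
    [NormedSpace ℝ V] {F : ι → Ω → ℝ} {DF : ι → Ω → H} (hF : ∀ i, IsSimple W (F i) (DF i))
    (b : ι → V) {g : V → ℝ} (hg : Function.HasTemperateGrowth g) :
    IsSimple W (fun ω => g (∑ i, F i ω • b i))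
      (fun ω => ∑ i, fderiv ℝ g (∑ j, F j ω • b j) (b i) • DF i ω) := by
  classical
  choose n f h hf hF hDF using hF
  -- The Gaussian arguments of all the `F i` are concatenated into one vector, indexed through `e`;
  -- `π i` recovers the block belonging to `F i`.
  let e := Fintype.equivFin (Σ i, Fin (n i))
  let π : ∀ i, EuclideanSpace ℝ (Fin (Fintype.card (Σ i, Fin (n i)))) →L[ℝ]
      EuclideanSpace ℝ (Fin (n i)) := fun i => LinearMap.toContinuousLinearMap
    { toFun := fun x => WithLp.toLp 2 fun a => x (e ⟨i, a⟩)
      map_add' := fun x y => by ext; simp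
      map_smul' := fun c x => by ext; simp }
  have hπ : ∀ i x a, π i x a = x (e ⟨i, a⟩) := fun i x a => rfl
  let K : Fin (Fintype.card (Σ i, Fin (n i))) → H := fun k => h (e.symm k).1 (e.symm k).2
  have hKe : ∀ i a, K (e ⟨i, a⟩) = h i a := fun i a =>
    congrArg (fun p : Σ i, Fin (n i) => h p.1 p.2) (e.symm_apply_apply ⟨i, a⟩)
  have hπW : ∀ i ω, π i (WithLp.toLp 2 fun k => W (K k) ω)
      = WithLp.toLp 2 fun a => W (h i a) ω := by
    intro i ω
    ext a
    simp [hπ, hKe]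
  have hsum : ∀ i (L : EuclideanSpace ℝ (Fin (n i)) →L[ℝ] ℝ),
      ∑ k, L (π i (EuclideanSpace.single k 1)) • K k
        = ∑ a, L (EuclideanSpace.single a 1) • h i a := by
    intro i L
    rw [← e.sum_comp, Fintype.sum_sigma, Finset.sum_eq_single i]
    · refine Finset.sum_congr rfl fun a _ => ?_
      rw [hKe]
      congr 2
      ext a'
      simp [hπ]
    · intro j _ hj
      refine Finset.sum_eq_zero fun a _ => ?_
      have : π i (EuclideanSpace.single (e ⟨j, a⟩) 1) = 0 := by
        ext a'
        simp [hπ, Ne.symm hj]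
      simp [this]
    · simp
  have hΦ : Function.HasTemperateGrowth fun x => ∑ i, f i (π i x) • b i := by
    refine Function.HasTemperateGrowth.sum fun i _ => ?_
    exact Function.HasTemperateGrowth.smul (𝕜 := ℝ) ((hf i).comp (π i).hasTemperateGrowth)
      (Function.HasTemperateGrowth.const (b i))
  refine ⟨_, fun x => g (∑ i, f i (π i x) • b i), K, hg.comp hΦ, ?_, ?_⟩
  · intro ω
    simp only [hπW, hF]
  · intro ω
    set x := WithLp.toLp 2 fun k => W (K k) ω with hx
    have h1 : ∀ i, HasFDerivAt (fun x => f i (π i x)) ((fderiv ℝ (f i) (π i x)).comp (π i)) x :=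
      fun i => (((hf i).1.differentiable (by simp)) (π i x)).hasFDerivAt.comp x
        (π i).hasFDerivAt
    have h2 : HasFDerivAt (fun x => ∑ i, f i (π i x) • b i)
        (∑ i, ((fderiv ℝ (f i) (π i x)).comp (π i)).smulRight (b i)) x :=
      HasFDerivAt.fun_sum fun i _ => (h1 i).smul_const (b i)
    have h3 := ((hg.1.differentiable (by simp)) (∑ i, f i (π i x) • b i)).hasFDerivAt.comp x h2
    have h4 : fderiv ℝ (fun x => g (∑ i, f i (π i x) • b i)) x = _ := h3.fderiv
    rw [h4]
    have h5 : ∑ i, f i (π i x) • b i = ∑ i, F i ω • b i := by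
      simp only [hx, hπW, hF]
    rw [h5]
    simp only [ContinuousLinearMap.comp_apply, _root_.sum_apply,
      ContinuousLinearMap.smulRight_apply, map_sum, map_smul, smul_eq_mul, Finset.sum_smul]
    rw [Finset.sum_comm]
    refine Finset.sum_congr rfl fun i _ => ?_
    rw [hDF, ← hπW, ← hx, ← hsum i, Finset.smul_sum]
    refine Finset.sum_congr rfl fun k _ => ?_
    rw [smul_smul, mul_comm]

theorem IsSimple.hasMalliavinDeriv {P : Measure Ω} {F : Ω → ℝ} {DF : Ω → H}
    (hF : IsSimple W F DF) (h1 : MemLp F 2 P) (h2 : MemLp DF 2 P) :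
    HasMalliavinDeriv W P F DF :=
  ⟨h1, h2, fun _ => F, fun _ => DF, fun _ => hF, by simp, by simp⟩

end Simple

/-! ### Skorohod duality combined with the chain rule -/

section Duality

variable {Ω : Type*} [MeasurableSpace Ω] {H : Type*} [NormedAddCommGroup H]
  [InnerProductSpace ℝ H] {W : H → Ω → ℝ} {P : Measure Ω}

/-- Split `φₙ Tₙ = φₙ T' + φₙ (Tₙ - T')`: dominated convergence handles the first term, and the
uniform bound on `φₙ` with `L¹` convergence of `Tₙ` the second. -/
theorem tendsto_integral_mul_of_bounded {φ : ℕ → Ω → ℝ} {φ' : Ω → ℝ} {T : ℕ → Ω → ℝ}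
    {T' : Ω → ℝ} {C : ℝ} (hφm : ∀ n, AEStronglyMeasurable (φ n) P) (hφC : ∀ n ω, |φ n ω| ≤ C)
    (hφ : ∀ᵐ ω ∂P, Tendsto (fun n => φ n ω) atTop (𝓝 (φ' ω))) (hT' : Integrable T' P)
    (hT : ∀ᶠ n in atTop, Integrable (T n) P)
    (hTT' : Tendsto (fun n => eLpNorm (T n - T') 1 P) atTop (𝓝 0)) :
    Tendsto (fun n => ∫ ω, φ n ω * T n ω ∂P) atTop (𝓝 (∫ ω, φ' ω * T' ω ∂P)) := by
  have h1 : Tendsto (fun n => ∫ ω, φ n ω * T' ω ∂P) atTop (𝓝 (∫ ω, φ' ω * T' ω ∂P)) := by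
    refine tendsto_integral_of_dominated_convergence (fun ω => C * |T' ω|)
      (fun n => (hφm n).mul hT'.1) (hT'.abs.const_mul C) (fun n => ?_) ?_
    · refine Eventually.of_forall fun ω => ?_
      rw [Real.norm_eq_abs, abs_mul]
      exact mul_le_mul_of_nonneg_right (hφC n ω) (abs_nonneg _)
    · filter_upwards [hφ] with ω hω using hω.mul_const _
  have h2 : Tendsto (fun n => ∫ ω, φ n ω * T n ω ∂P - ∫ ω, φ n ω * T' ω ∂P) atTop (𝓝 0) := by
    have h3 : Tendsto (fun n => C * (eLpNorm (T n - T') 1 P).toReal) atTop (𝓝 0) := by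
      have := ((ENNReal.tendsto_toReal ENNReal.zero_ne_top).comp hTT').const_mul C
      simpa using this
    refine squeeze_zero_norm' ?_ h3
    filter_upwards [hT] with n hn
    have hb : ∀ S : Ω → ℝ, Integrable S P → Integrable (fun ω => φ n ω * S ω) P := fun S hS =>
      hS.bdd_mul (c := C) (hφm n) (Eventually.of_forall fun ω => hφC n ω)
    rw [← integral_sub (hb _ hn) (hb _ hT')]
    have hd : Integrable (T n - T') P := hn.sub hT'
    rw [eLpNorm_one_eq_lintegral_enorm, ← integral_norm_eq_lintegral_enorm hd.1,
      ← integral_const_mul]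
    refine norm_integral_le_of_norm_le (hd.norm.const_mul C) (Eventually.of_forall fun ω => ?_)
    rw [← mul_sub, norm_mul]
    exact mul_le_mul_of_nonneg_right (hφC n ω) (norm_nonneg _)
  simpa using h2.add h1

theorem integrable_inner_of_memLp {v w : Ω → H} (hv : MemLp v 2 P) (hw : MemLp w 2 P) :
    Integrable (fun ω => ⟪v ω, w ω⟫) P := by
  refine (hv.norm.integrable_mul hw.norm).mono (hv.1.inner hw.1) (Eventually.of_forall fun ω => ?_)
  simpa using abs_real_inner_le_norm (v ω) (w ω)

theorem eLpNorm_inner_le {v w : Ω → H} (hv : MemLp v 2 P) (hw : MemLp w 2 P) :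
    eLpNorm (fun ω => ⟪v ω, w ω⟫) 1 P ≤ eLpNorm v 2 P * eLpNorm w 2 P := by
  have := eLpNorm_le_eLpNorm_mul_eLpNorm_of_nnnorm (p := 2) (q := 2) (r := 1) hv.1 hw.1
    (fun x y => ⟪x, y⟫) 1 (Eventually.of_forall fun ω => by
      simpa using nnnorm_inner_le_nnnorm (𝕜 := ℝ) (v ω) (w ω))
  simpa using this

/-- A finite family in `𝔻^{1,2}` can be approximated by simple random variables which converge
almost surely. -/
theorem exists_isSimple_tendsto (hW : ∀ h, Measurable (W h)) {ι : Type*} [Fintype ι]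
    {Z : ι → Ω → ℝ} {DZ : ι → Ω → H} (hZ : ∀ i, HasMalliavinDeriv W P (Z i) (DZ i)) :
    ∃ (F : ℕ → ι → Ω → ℝ) (DF : ℕ → ι → Ω → H), (∀ n i, IsSimple W (F n i) (DF n i)) ∧
      (∀ᵐ ω ∂P, ∀ i, Tendsto (fun n => F n i ω) atTop (𝓝 (Z i ω))) ∧
      ∀ i, Tendsto (fun n => eLpNorm (DF n i - DZ i) 2 P) atTop (𝓝 0) := by
  choose F DF hs hF hDF using fun i => (hZ i).exists_approx
  have hm : ∀ i n, AEStronglyMeasurable (F i n - Z i) P := fun i n =>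
    ((hs i n).measurable hW).aestronglyMeasurable.sub (hZ i).memLp.1
  -- Adding the errors over `i` lets a single subsequence converge almost surely for the whole
  -- family.
  have h1 : Tendsto (fun n => eLpNorm (∑ i, fun ω => ‖(F i n - Z i) ω‖) 2 P) atTop (𝓝 0) := by
    have h2 : Tendsto (fun n => ∑ i, eLpNorm (F i n - Z i) 2 P) atTop (𝓝 0) := by
      simpa using tendsto_finsetSum Finset.univ fun i _ => hF i
    refine tendsto_of_tendsto_of_tendsto_of_le_of_le tendsto_const_nhds h2 (fun _ => zero_le)
      fun n => ?_
    refine (eLpNorm_sum_le (fun i _ => (hm i n).norm) (by norm_num)).trans ?_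
    exact Finset.sum_le_sum fun i _ => (eLpNorm_norm _).le
  have h3 : TendstoInMeasure P (fun n => ∑ i, fun ω => ‖(F i n - Z i) ω‖) atTop
      (fun _ => (0 : ℝ)) := by
    refine tendstoInMeasure_of_tendsto_eLpNorm (p := 2) (by norm_num) (fun n => ?_)
      aestronglyMeasurable_const ?_
    · exact Finset.aestronglyMeasurable_sum _ fun i _ => (hm i n).norm
    · refine h1.congr fun n => ?_
      congr 1
      ext ω
      simp
  obtain ⟨ns, hns, hae⟩ := h3.exists_seq_tendsto_ae
  refine ⟨fun n i => F i (ns n), fun n i => DF i (ns n), fun n i => hs i _, ?_,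
    fun i => (hDF i).comp hns.tendsto_atTop⟩
  filter_upwards [hae] with ω hω i
  rw [tendsto_iff_norm_sub_tendsto_zero]
  refine squeeze_zero (fun _ => norm_nonneg _) (fun n => ?_) hω
  rw [Finset.sum_apply]
  exact Finset.single_le_sum (f := fun j => ‖(F j (ns n) - Z j) ω‖) (fun _ _ => norm_nonneg _)
    (Finset.mem_univ i)

variable {ι : Type*} [Fintype ι] {V : Type*} [NormedAddCommGroup V] [NormedSpace ℝ V]

/-- The duality formula `E[X g(U)] = E[⟨v, D(g(U))⟩]` for the vector `U = ∑ᵢ Zᵢ bᵢ`, with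
`D(g(U))` expanded by the chain rule. -/
def ChainDuality (P : Measure Ω) (v : Ω → H) (X : Ω → ℝ) (Z : ι → Ω → ℝ) (DZ : ι → Ω → H)
    (b : ι → V) (g : V → ℝ) : Prop :=
  ∫ ω, X ω * g (∑ i, Z i ω • b i) ∂P
    = ∑ i, ∫ ω, fderiv ℝ g (∑ j, Z j ω • b j) (b i) * ⟪v ω, DZ i ω⟫ ∂P

theorem aestronglyMeasurable_sum_smul {Z : ι → Ω → ℝ} (hZ : ∀ i, AEStronglyMeasurable (Z i) P)
    (b : ι → V) : AEStronglyMeasurable (fun ω => ∑ i, Z i ω • b i) P :=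
  Finset.aestronglyMeasurable_fun_sum _ fun i _ => (hZ i).smul_const (b i)

/-- Here `g(U)` is itself simple, so its derivative is explicit; the bounds on `g` and its
derivative put it in `𝔻^{1,2}`, where duality applies directly. -/
theorem ChainDuality.of_isSimple [IsFiniteMeasure P] (hW : ∀ h, Measurable (W h)) {v : Ω → H}
    {X : Ω → ℝ} (hX : IsSkorohodIntegral W P v X) {F : ι → Ω → ℝ} {DF : ι → Ω → H}
    (hF : ∀ i, IsSimple W (F i) (DF i)) (hDF : ∀ i, MemLp (DF i) 2 P) (b : ι → V) {g : V → ℝ}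
    (hg : Function.HasTemperateGrowth g) {C : ℝ} (hC : ∀ x, |g x| ≤ C)
    (hC' : ∀ x, ‖fderiv ℝ g x‖ ≤ C) : ChainDuality P v X F DF b g := by
  have hm : AEStronglyMeasurable (fun ω => ∑ i, F i ω • b i) P :=
    aestronglyMeasurable_sum_smul (fun i => ((hF i).measurable hW).aestronglyMeasurable) b
  have hgc : ∀ a, Continuous fun x => fderiv ℝ g x a := fun a =>
    (hg.1.continuous_fderiv (by simp)).clm_apply continuous_const
  have hfd : ∀ a x, ‖fderiv ℝ g x a‖ ≤ C * ‖a‖ := fun a x =>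
    (ContinuousLinearMap.le_opNorm _ _).trans (mul_le_mul_of_nonneg_right (hC' x) (norm_nonneg a))
  have hs := IsSimple.comp_sum_smul hF b hg
  have h1 : MemLp (fun ω => g (∑ i, F i ω • b i)) 2 P :=
    MemLp.of_bound (hg.1.continuous.comp_aestronglyMeasurable hm) C
      (Eventually.of_forall fun ω => hC _)
  have h2 : MemLp (fun ω => ∑ i, fderiv ℝ g (∑ j, F j ω • b j) (b i) • DF i ω) 2 P := by
    refine memLp_finsetSum _ fun i _ => ?_
    refine MemLp.of_le_mul (c := C * ‖b i‖) (hDF i)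
      (((hgc (b i)).comp_aestronglyMeasurable hm).smul (hDF i).1)
      (Eventually.of_forall fun ω => ?_)
    rw [norm_smul]
    exact mul_le_mul_of_nonneg_right (hfd _ _) (norm_nonneg _)
  rw [ChainDuality, hX.duality _ _ (hs.hasMalliavinDeriv h1 h2), ← integral_finsetSum]
  · simp only [inner_sum, real_inner_smul_right]
  · intro i _
    exact (integrable_inner_of_memLp hX.memLp_integrand (hDF i)).bdd_mul (c := C * ‖b i‖)
      ((hgc (b i)).comp_aestronglyMeasurable hm) (Eventually.of_forall fun ω => hfd _ _)

/-- The limit is taken in the integrated identity, so no chain rule in `𝔻^{1,2}` is required: `g`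
and its derivative converge almost surely and boundedly along the approximations, while `⟨v, DFₙ⟩`
converges in `L¹`. -/
theorem ChainDuality.of_hasTemperateGrowth [IsFiniteMeasure P] (hW : ∀ h, Measurable (W h))
    {v : Ω → H} {X : Ω → ℝ} (hX : IsSkorohodIntegral W P v X) {Z : ι → Ω → ℝ} {DZ : ι → Ω → H}
    (hZ : ∀ i, HasMalliavinDeriv W P (Z i) (DZ i)) (b : ι → V) {g : V → ℝ}
    (hg : Function.HasTemperateGrowth g) {C : ℝ} (hC : ∀ x, |g x| ≤ C)
    (hC' : ∀ x, ‖fderiv ℝ g x‖ ≤ C) : ChainDuality P v X Z DZ b g := by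
  obtain ⟨F, DF, hs, hF, hDF⟩ := exists_isSimple_tendsto hW hZ
  have hm : ∀ n, AEStronglyMeasurable (fun ω => ∑ i, F n i ω • b i) P := fun n =>
    aestronglyMeasurable_sum_smul (fun i => ((hs n i).measurable hW).aestronglyMeasurable) b
  have hgc : ∀ a, Continuous fun x => fderiv ℝ g x a := fun a =>
    (hg.1.continuous_fderiv (by simp)).clm_apply continuous_const
  have hfd : ∀ a x, |fderiv ℝ g x a| ≤ C * ‖a‖ := fun a x =>
    (ContinuousLinearMap.le_opNorm _ _).trans (mul_le_mul_of_nonneg_right (hC' x) (norm_nonneg a))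
  -- Square integrability of the approximating derivatives comes from the convergence itself: the
  -- `L²` distance to `DZ i` is eventually finite.
  have hDFm : ∀ᶠ n in atTop, ∀ i, MemLp (DF n i) 2 P := by
    refine eventually_all.2 fun i => ?_
    filter_upwards [(hDF i).eventually_lt_const ENNReal.zero_lt_top] with n hn
    have h1 : MemLp (DF n i - DZ i) 2 P :=
      ⟨((hs n i).stronglyMeasurable_deriv hW).aestronglyMeasurable.sub (hZ i).memLp_deriv.1, hn⟩
    simpa using h1.add (hZ i).memLp_deriv
  have hU : ∀ᵐ ω ∂P, Tendsto (fun n => ∑ i, F n i ω • b i) atTop (𝓝 (∑ i, Z i ω • b i)) := by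
    filter_upwards [hF] with ω hω
    exact tendsto_finsetSum _ fun i _ => (hω i).smul_const (b i)
  have hleft : Tendsto (fun n => ∫ ω, X ω * g (∑ i, F n i ω • b i) ∂P) atTop
      (𝓝 (∫ ω, X ω * g (∑ i, Z i ω • b i) ∂P)) := by
    have hXi : Integrable X P := hX.memLp.integrable (by norm_num)
    simp only [mul_comm (X _)]
    refine tendsto_integral_mul_of_bounded (C := C) (T := fun _ => X)
      (fun n => hg.1.continuous.comp_aestronglyMeasurable (hm n)) (fun n ω => hC _) ?_ hXi
      (Eventually.of_forall fun _ => hXi) (by simp)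
    filter_upwards [hU] with ω hω using (hg.1.continuous.tendsto _).comp hω
  have hright : Tendsto (fun n => ∑ i, ∫ ω, fderiv ℝ g (∑ j, F n j ω • b j) (b i)
        * ⟪v ω, DF n i ω⟫ ∂P) atTop
      (𝓝 (∑ i, ∫ ω, fderiv ℝ g (∑ j, Z j ω • b j) (b i) * ⟪v ω, DZ i ω⟫ ∂P)) := by
    refine tendsto_finsetSum _ fun i _ => ?_
    refine tendsto_integral_mul_of_bounded (C := C * ‖b i‖) (T := fun n ω => ⟪v ω, DF n i ω⟫)
      (fun n => (hgc _).comp_aestronglyMeasurable (hm n)) (fun n ω => hfd _ _) ?_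
      (integrable_inner_of_memLp hX.memLp_integrand (hZ i).memLp_deriv) ?_ ?_
    · filter_upwards [hU] with ω hω using ((hgc _).tendsto _).comp hω
    · filter_upwards [hDFm] with n hn using integrable_inner_of_memLp hX.memLp_integrand (hn i)
    · have h0 : Tendsto (fun n => eLpNorm v 2 P * eLpNorm (DF n i - DZ i) 2 P) atTop (𝓝 0) := by
        simpa using ENNReal.Tendsto.const_mul (hDF i) (Or.inr hX.memLp_integrand.2.ne)
      refine tendsto_of_tendsto_of_tendsto_of_le_of_le' tendsto_const_nhds h0
        (Eventually.of_forall fun _ => zero_le) ?_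
      filter_upwards [hDFm] with n hn
      refine le_trans (le_of_eq ?_)
        (eLpNorm_inner_le hX.memLp_integrand ((hn i).sub (hZ i).memLp_deriv))
      congr 1
      ext ω
      simp [inner_sub_right]
  refine tendsto_nhds_unique_of_eventuallyEq hleft hright ?_
  filter_upwards [hDFm] with n hn
  exact ChainDuality.of_isSimple hW hX (hs n) hn b hg hC hC'

theorem ChainDuality.of_tendsto {v : Ω → H} {X : Ω → ℝ} (hv : MemLp v 2 P)
    (hX : Integrable X P) {Z : ι → Ω → ℝ} {DZ : ι → Ω → H}
    (hZ : ∀ i, AEStronglyMeasurable (Z i) P) (hDZ : ∀ i, MemLp (DZ i) 2 P) (b : ι → V)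
    {g : ℕ → V → ℝ} {g' : V → ℝ} (hg : ∀ n, ContDiff ℝ 1 (g n)) {C : ℝ}
    (hC : ∀ n x, |g n x| ≤ C) (hC' : ∀ n x, ‖fderiv ℝ (g n) x‖ ≤ C)
    (hlim : ∀ x, Tendsto (fun n => g n x) atTop (𝓝 (g' x)))
    (hlim' : ∀ x, Tendsto (fun n => fderiv ℝ (g n) x) atTop (𝓝 (fderiv ℝ g' x)))
    (h : ∀ n, ChainDuality P v X Z DZ b (g n)) : ChainDuality P v X Z DZ b g' := by
  have hm := aestronglyMeasurable_sum_smul hZ b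
  have hleft : Tendsto (fun n => ∫ ω, X ω * g n (∑ i, Z i ω • b i) ∂P) atTop
      (𝓝 (∫ ω, X ω * g' (∑ i, Z i ω • b i) ∂P)) := by
    simp only [mul_comm (X _)]
    exact tendsto_integral_mul_of_bounded (C := C) (T := fun _ => X)
      (fun n => (hg n).continuous.comp_aestronglyMeasurable hm) (fun n ω => hC _ _)
      (Eventually.of_forall fun ω => hlim _) hX (Eventually.of_forall fun _ => hX) (by simp)
  have hright : Tendsto (fun n => ∑ i, ∫ ω, fderiv ℝ (g n) (∑ j, Z j ω • b j) (b i)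
        * ⟪v ω, DZ i ω⟫ ∂P) atTop
      (𝓝 (∑ i, ∫ ω, fderiv ℝ g' (∑ j, Z j ω • b j) (b i) * ⟪v ω, DZ i ω⟫ ∂P)) := by
    refine tendsto_finsetSum _ fun i _ => ?_
    have hi := integrable_inner_of_memLp hv (hDZ i)
    refine tendsto_integral_mul_of_bounded (C := C * ‖b i‖) (T := fun _ ω => ⟪v ω, DZ i ω⟫)
      (fun n => ?_) (fun n ω => ?_)
      (Eventually.of_forall fun ω => ?_) hi (Eventually.of_forall fun _ => hi) (by simp)
    · exact (((hg n).continuous_fderiv (by simp)).clm_apply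
        continuous_const).comp_aestronglyMeasurable hm
    · exact (ContinuousLinearMap.le_opNorm _ _).trans
        (mul_le_mul_of_nonneg_right (hC' _ _) (norm_nonneg _))
    · exact ((ContinuousLinearMap.apply ℝ ℝ (b i)).continuous.tendsto _).comp (hlim' _)
  exact tendsto_nhds_unique_of_eventuallyEq hleft hright (Eventually.of_forall h)

end Duality

/-! ### Extension of the duality to bounded `C¹` functions -/

section Approximation

variable {V : Type*} [NormedAddCommGroup V] [NormedSpace ℝ V] [FiniteDimensional ℝ V]
  [MeasurableSpace V] [BorelSpace V]

open scoped Convolution ContDiff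

theorem norm_normed_convolution_le {E : Type*} [NormedAddCommGroup E] [NormedSpace ℝ E]
    {μ : Measure V} [μ.IsAddHaarMeasure] (φ : ContDiffBump (0 : V)) {g : V → E} {C : ℝ}
    (hC : ∀ x, ‖g x‖ ≤ C) (x : V) :
    ‖(φ.normed μ ⋆[ContinuousLinearMap.lsmul ℝ ℝ, μ] g) x‖ ≤ C := by
  have h : ∫ t, φ.normed μ t * C ∂μ = C := by
    rw [integral_mul_const, φ.integral_normed, one_mul]
  refine (norm_integral_le_of_norm_le (φ.integrable_normed.mul_const C)
    (Eventually.of_forall fun t => ?_)).trans_eq h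
  simp only [ContinuousLinearMap.lsmul_apply, norm_smul, Real.norm_eq_abs,
    abs_of_nonneg (φ.nonneg_normed t)]
  exact mul_le_mul_of_nonneg_left (hC _) (φ.nonneg_normed t)

omit [NormedSpace ℝ V] [FiniteDimensional ℝ V] [MeasurableSpace V] [BorelSpace V] in
theorem exists_contDiffBump_seq : ∃ φ : ℕ → ContDiffBump (0 : V),
    Tendsto (fun n => (φ n).rOut) atTop (𝓝 0) := by
  refine ⟨fun n => ⟨1 / (2 * (n + 1)), 1 / (n + 1), by positivity, ?_⟩, ?_⟩
  · exact one_div_lt_one_div_of_lt (by positivity) (by linarith [n.cast_nonneg (α := ℝ)])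
  · exact tendsto_one_div_add_atTop_nhds_zero_nat

/-- A compactly supported `C¹` function is a bounded pointwise limit, together with its
derivative, of compactly supported smooth functions. -/
theorem exists_smooth_tendsto {g : V → ℝ} (hg : ContDiff ℝ 1 g) (hgs : HasCompactSupport g)
    {C : ℝ} (hC : ∀ x, |g x| ≤ C) (hC' : ∀ x, ‖fderiv ℝ g x‖ ≤ C) :
    ∃ f : ℕ → V → ℝ, (∀ n, ContDiff ℝ ∞ (f n)) ∧ (∀ n, HasCompactSupport (f n)) ∧
      (∀ n x, |f n x| ≤ C) ∧ (∀ n x, ‖fderiv ℝ (f n) x‖ ≤ C) ∧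
      (∀ x, Tendsto (fun n => f n x) atTop (𝓝 (g x))) ∧
      ∀ x, Tendsto (fun n => fderiv ℝ (f n) x) atTop (𝓝 (fderiv ℝ g x)) := by
  obtain ⟨φ, hφ⟩ := exists_contDiffBump_seq (V := V)
  let μ : Measure V := Measure.addHaar
  have hd : ∀ n x, fderiv ℝ ((φ n).normed μ ⋆[ContinuousLinearMap.lsmul ℝ ℝ, μ] g) x
      = ((φ n).normed μ ⋆[ContinuousLinearMap.lsmul ℝ ℝ, μ] fderiv ℝ g) x := fun n x =>
    (hgs.hasFDerivAt_convolution_right (ContinuousLinearMap.lsmul ℝ ℝ)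
      (φ n).integrable_normed.locallyIntegrable hg x).fderiv
  refine ⟨fun n => (φ n).normed μ ⋆[ContinuousLinearMap.lsmul ℝ ℝ, μ] g, fun n => ?_, fun n => ?_,
    fun n x => norm_normed_convolution_le (φ n) (μ := μ) (g := g) hC x, fun n x => ?_,
    fun x => ?_, fun x => ?_⟩
  · exact (φ n).hasCompactSupport_normed.contDiff_convolution_left _ (φ n).contDiff_normed
      hg.continuous.locallyIntegrable
  · exact (φ n).hasCompactSupport_normed.convolution _ hgs
  · rw [hd]
    exact norm_normed_convolution_le (φ n) (μ := μ) (g := fderiv ℝ g) hC' x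
  · exact ContDiffBump.convolution_tendsto_right_of_continuous hφ hg.continuous x
  · refine Tendsto.congr (fun n => (hd n x).symm) ?_
    exact ContDiffBump.convolution_tendsto_right_of_continuous hφ
      (hg.continuous_fderiv (by simp)) x

omit [MeasurableSpace V] [BorelSpace V] in
/-- A bounded `C¹` function with bounded derivative is a bounded pointwise limit, together with
its derivative, of compactly supported `C¹` functions. -/
theorem exists_hasCompactSupport_tendsto {g : V → ℝ} (hg : ContDiff ℝ 1 g)
    {C : ℝ} (hC : ∀ x, |g x| ≤ C) (hC' : ∀ x, ‖fderiv ℝ g x‖ ≤ C) :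
    ∃ (f : ℕ → V → ℝ) (C₁ : ℝ), (∀ n, ContDiff ℝ 1 (f n)) ∧ (∀ n, HasCompactSupport (f n)) ∧
      (∀ n x, |f n x| ≤ C₁) ∧ (∀ n x, ‖fderiv ℝ (f n) x‖ ≤ C₁) ∧
      (∀ x, Tendsto (fun n => f n x) atTop (𝓝 (g x))) ∧
      ∀ x, Tendsto (fun n => fderiv ℝ (f n) x) atTop (𝓝 (fderiv ℝ g x)) := by
  have hC0 : 0 ≤ C := (abs_nonneg _).trans (hC 0)
  let ψ : ContDiffBump (0 : V) := ⟨1, 2, one_pos, one_lt_two⟩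
  have hψ : ContDiff ℝ 1 ψ := ψ.contDiff
  obtain ⟨B, hB⟩ := (ψ.hasCompactSupport.fderiv (𝕜 := ℝ)).exists_bound_of_continuous
    (hψ.continuous_fderiv (by simp))
  have hB0 : 0 ≤ B := (norm_nonneg _).trans (hB 0)
  have hr : ∀ n : ℕ, (0 : ℝ) < ((n : ℝ) + 1)⁻¹ := fun n => by positivity
  have hr1 : ∀ n : ℕ, ((n : ℝ) + 1)⁻¹ ≤ 1 := fun n =>
    inv_le_one_of_one_le₀ (by linarith [n.cast_nonneg (α := ℝ)])
  have hψd : ∀ (n : ℕ) x, HasFDerivAt (fun x => ψ (((n : ℝ) + 1)⁻¹ • x))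
      (((n : ℝ) + 1)⁻¹ • fderiv ℝ ψ (((n : ℝ) + 1)⁻¹ • x)) x := by
    intro n x
    have h := ((hψ.differentiable (by simp)) (((n : ℝ) + 1)⁻¹ • x)).hasFDerivAt.comp x
      ((hasFDerivAt_id x).const_smul (((n : ℝ) + 1)⁻¹))
    refine h.congr_fderiv ?_
    ext y
    simp
  have hsmul : ∀ n : ℕ, ContDiff ℝ 1 fun x : V => ψ (((n : ℝ) + 1)⁻¹ • x) := fun n =>
    hψ.comp (contDiff_const_smul _)
  -- For large `n` the rescaled cutoff equals `1` on a neighbourhood of `x`, not only at `x`; this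
  -- gives convergence of values and of derivatives at once.
  have hev : ∀ x, ∀ᶠ n : ℕ in atTop,
      (fun y => ψ (((n : ℝ) + 1)⁻¹ • y) * g y) =ᶠ[𝓝 x] g := by
    intro x
    have h0 : Tendsto (fun n : ℕ => ((n : ℝ) + 1)⁻¹ • x) atTop (𝓝 0) := by
      have := (tendsto_one_div_add_atTop_nhds_zero_nat (𝕜 := ℝ)).smul_const x
      simpa using this
    filter_upwards [h0.eventually (Metric.ball_mem_nhds 0 one_pos)] with n hn
    have hc : Tendsto (fun y => ((n : ℝ) + 1)⁻¹ • y) (𝓝 x) (𝓝 (((n : ℝ) + 1)⁻¹ • x)) :=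
      (continuous_const_smul _).tendsto x
    filter_upwards [hc.eventually (Metric.isOpen_ball.mem_nhds hn)] with y hy
    rw [ψ.one_of_mem_closedBall (Metric.ball_subset_closedBall hy), one_mul]
  refine ⟨fun n x => ψ (((n : ℝ) + 1)⁻¹ • x) * g x, C + B * C, fun n => (hsmul n).mul hg,
    fun n => ?_, fun n x => ?_, fun n x => ?_, fun x => ?_, fun x => ?_⟩
  · exact (ψ.hasCompactSupport.comp_smul (hr n).ne').mul_right
  · rw [abs_mul, abs_of_nonneg ψ.nonneg]
    have := mul_le_mul ψ.le_one (hC x) (abs_nonneg _) zero_le_one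
      (a := ψ (((n : ℝ) + 1)⁻¹ • x))
    nlinarith [mul_nonneg hB0 hC0]
  · have h := (hψd n x).mul ((hg.differentiable (by simp)) x).hasFDerivAt
    have h' : fderiv ℝ (fun x => ψ (((n : ℝ) + 1)⁻¹ • x) * g x) x = _ := h.fderiv
    rw [h']
    refine (norm_add_le _ _).trans (add_le_add ?_ ?_)
    · rw [norm_smul, Real.norm_eq_abs, abs_of_nonneg ψ.nonneg]
      exact (mul_le_mul ψ.le_one (hC' x) (norm_nonneg _) zero_le_one).trans_eq (one_mul C)
    · rw [norm_smul, norm_smul, Real.norm_eq_abs, Real.norm_eq_abs, abs_of_pos (hr n), mul_comm]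
      refine mul_le_mul ?_ (hC x) (abs_nonneg _) hB0
      exact (mul_le_mul (hr1 n) (hB _) (norm_nonneg _) zero_le_one).trans_eq (one_mul B)
  · refine tendsto_const_nhds.congr' ?_
    filter_upwards [hev x] with n hn using hn.self_of_nhds.symm
  · refine tendsto_const_nhds.congr' ?_
    filter_upwards [hev x] with n hn using hn.fderiv_eq.symm

variable {Ω : Type*} [MeasurableSpace Ω] {H : Type*} [NormedAddCommGroup H]
  [InnerProductSpace ℝ H] {W : H → Ω → ℝ} {P : Measure Ω} {ι : Type*} [Fintype ι]

omit [MeasurableSpace V] [BorelSpace V] in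
/-- Skorohod duality for a `C¹` function, bounded and with bounded derivative, of finitely many
elements of `𝔻^{1,2}`. -/
theorem IsSkorohodIntegral.chainDuality [IsFiniteMeasure P] (hW : ∀ h, Measurable (W h))
    {v : Ω → H} {X : Ω → ℝ} (hX : IsSkorohodIntegral W P v X) {Z : ι → Ω → ℝ} {DZ : ι → Ω → H}
    (hZ : ∀ i, HasMalliavinDeriv W P (Z i) (DZ i)) (b : ι → V) {g : V → ℝ}
    (hg : ContDiff ℝ 1 g) {C : ℝ} (hC : ∀ x, |g x| ≤ C) (hC' : ∀ x, ‖fderiv ℝ g x‖ ≤ C) :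
    ChainDuality P v X Z DZ b g := by
  borelize V
  have hXi : Integrable X P := hX.memLp.integrable (by norm_num)
  -- Truncation followed by mollification reaches smooth compactly supported functions, which have
  -- the temperate growth required of simple random variables.
  obtain ⟨f, C₁, hf, hfs, hf1, hf2, hf3, hf4⟩ := exists_hasCompactSupport_tendsto hg hC hC'
  refine ChainDuality.of_tendsto hX.memLp_integrand hXi (fun i => (hZ i).memLp.1)
    (fun i => (hZ i).memLp_deriv) b hf hf1 hf2 hf3 hf4 fun n => ?_
  obtain ⟨k, hk, hks, hk1, hk2, hk3, hk4⟩ := exists_smooth_tendsto (hf n) (hfs n) (hf1 n) (hf2 n)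
  refine ChainDuality.of_tendsto hX.memLp_integrand hXi (fun i => (hZ i).memLp.1)
    (fun i => (hZ i).memLp_deriv) b (fun m => (hk m).of_le (by simp)) hk1 hk2 hk3 hk4 fun m => ?_
  exact ChainDuality.of_hasTemperateGrowth hW hX hZ b ((hks m).hasTemperateGrowth (hk m))
    (hk1 m) (hk2 m)

end Approximation

/-! ### Gaussian integration by parts and smoothing -/

section Gaussian

theorem integrable_gaussianReal_iff {m : ℝ} {v : ℝ≥0} (hv : v ≠ 0) {f : ℝ → ℝ} :
    Integrable f (gaussianReal m v) ↔ Integrable fun x => gaussianPDFReal m v x * f x := by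
  rw [gaussianReal_of_var_ne_zero m hv,
    integrable_withDensity_iff_integrable_smul' (measurable_gaussianPDF m v)
      (Eventually.of_forall fun x => gaussianPDF_lt_top)]
  simp [toReal_gaussianPDF]

theorem integrable_id_gaussianReal (m : ℝ) (v : ℝ≥0) :
    Integrable (fun x => x) (gaussianReal m v) :=
  (memLp_id_gaussianReal (μ := m) (v := v) 1).integrable (by simp)

theorem integrable_sq_gaussianReal (m : ℝ) (v : ℝ≥0) :
    Integrable (fun x => x ^ 2) (gaussianReal m v) :=
  (memLp_id_gaussianReal (μ := m) (v := v) 2).integrable_sq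

theorem hasDerivAt_gaussianPDFReal {v : ℝ≥0} (hv : v ≠ 0) (x : ℝ) :
    HasDerivAt (gaussianPDFReal 0 v) (-(x / v) * gaussianPDFReal 0 v x) x := by
  have hv' : (v : ℝ) ≠ 0 := by exact_mod_cast hv
  have h1 : HasDerivAt (fun x : ℝ => -(x - 0) ^ 2 / (2 * v)) (-(x / v)) x := by
    have h := ((((hasDerivAt_id x).sub_const 0).pow 2).neg).div_const (2 * (v : ℝ))
    refine h.congr_deriv ?_
    simp
    field_simp
  have h2 := (h1.exp).const_mul (√(2 * Real.pi * v))⁻¹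
  rw [gaussianPDFReal_def]
  refine h2.congr_deriv ?_
  ring

/-- Gaussian integration by parts. -/
theorem integral_id_mul_gaussianReal {v : ℝ≥0} (hv : v ≠ 0) {f f' : ℝ → ℝ}
    (hf : ∀ x, HasDerivAt f (f' x) x) (h0 : Integrable f (gaussianReal 0 v))
    (h1 : Integrable f' (gaussianReal 0 v))
    (h2 : Integrable (fun x => x * f x) (gaussianReal 0 v)) :
    ∫ x, x * f x ∂gaussianReal 0 v = v * ∫ x, f' x ∂gaussianReal 0 v := by
  have hv' : (v : ℝ) ≠ 0 := by exact_mod_cast hv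
  rw [integral_gaussianReal_eq_integral_smul hv, integral_gaussianReal_eq_integral_smul hv]
  rw [integrable_gaussianReal_iff hv] at h0 h1 h2
  have hd : ∀ x, -(x / v) * gaussianPDFReal 0 v x * f x
      = -(v : ℝ)⁻¹ * (gaussianPDFReal 0 v x * (x * f x)) := fun x => by ring
  have h := integral_mul_deriv_eq_deriv_mul_of_integrable
    (fun x _ => hasDerivAt_gaussianPDFReal hv x) (fun x _ => hf x) h1
    ((h2.const_mul (-(v : ℝ)⁻¹)).congr (Eventually.of_forall fun x => (hd x).symm)) h0
  simp only [smul_eq_mul]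
  rw [h]
  simp only [hd]
  rw [integral_const_mul]
  field_simp

variable {E : Type*} [NormedAddCommGroup E] [NormedSpace ℝ E]


/-- Gaussian smoothing, in the first variable, of the partial derivative `∂₁h` of a `C¹` function
`h` with bounded derivative: it is again `C¹`, and its derivative is an integral of that of `h`. -/
theorem exists_gaussian_smoothing {v : ℝ≥0} (hv : v ≠ 0) {h : ℝ × E → ℝ} (hh : ContDiff ℝ 1 h)
    {L : ℝ} (hL : ∀ p, ‖fderiv ℝ h p‖ ≤ L) (s : ℝ) {c : ℝ} (hc : c ≠ 0) :
    ∃ (g : ℝ × E → ℝ) (C : ℝ), ContDiff ℝ 1 g ∧ (∀ p, |g p| ≤ C) ∧ (∀ p, ‖fderiv ℝ g p‖ ≤ C) ∧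
      (∀ p, g p = ∫ n, fderiv ℝ h (s * p.1 + c * n, p.2) (1, 0) ∂gaussianReal 0 v) ∧
      ∀ p a, c * v * fderiv ℝ g p a
        = ∫ n, n * fderiv ℝ h (s * p.1 + c * n, p.2) (s * a.1, a.2) ∂gaussianReal 0 v := by
  have hv' : (v : ℝ) ≠ 0 := by exact_mod_cast hv
  have hL0 : 0 ≤ L := (norm_nonneg _).trans (hL 0)
  have hhd : Differentiable ℝ h := hh.differentiable (by simp)
  have hhc : Continuous (fderiv ℝ h) := hh.continuous_fderiv (by simp)
  let γ := gaussianReal 0 v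
  let T : ℝ × E →L[ℝ] ℝ × E :=
    (s • ContinuousLinearMap.fst ℝ ℝ E).prod (ContinuousLinearMap.snd ℝ ℝ E)
  have hT : ∀ a, T a = (s * a.1, a.2) := fun a => rfl
  let q : ℝ × E → ℝ → ℝ × E := fun p n => (s * p.1 + c * n, p.2)
  have hq : Continuous fun x : (ℝ × E) × ℝ => q x.1 x.2 := by fun_prop
  have hqd : ∀ p n, HasFDerivAt (fun p => q p n) T p := by
    intro p n
    have h1 : HasFDerivAt (fun p => T p + (c * n, 0)) T p := T.hasFDerivAt.add_const _
    refine h1.congr_of_eventuallyEq (Eventually.of_forall fun p => ?_)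
    simp [q, hT]
  have hid : Integrable (fun n => n) γ := integrable_id_gaussianReal 0 v
  have hidn : Integrable (fun n : ℝ => |n|) γ := hid.abs
  have hsq : Integrable (fun n => n ^ 2) γ := integrable_sq_gaussianReal 0 v
  have hgrow : ∀ p n, |h (q p n)| ≤ |h (q p 0)| + L * (|c| * |n|) := by
    intro p n
    have h1 := Convex.norm_image_sub_le_of_norm_fderiv_le (𝕜 := ℝ) (f := h) (s := Set.univ)
      (fun x _ => hhd x) (fun x _ => hL x) convex_univ (Set.mem_univ (q p 0))
      (Set.mem_univ (q p n))
    have h2 : q p n - q p 0 = (c * n, 0) := by simp [q]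
    rw [h2, Real.norm_eq_abs, Prod.norm_mk, norm_zero, max_eq_left (norm_nonneg _), norm_mul,
      Real.norm_eq_abs, Real.norm_eq_abs] at h1
    have := abs_sub_abs_le_abs_sub (h (q p n)) (h (q p 0))
    linarith
  have hhq : ∀ p, Continuous fun n => h (q p n) := fun p =>
    hh.continuous.comp (hq.comp (Continuous.prodMk_right p))
  have hi0 : ∀ p, Integrable (fun n => h (q p n)) γ := fun p =>
    ((integrable_const |h (q p 0)|).add ((hidn.const_mul |c|).const_mul L)).mono'
      (hhq p).aestronglyMeasurable (Eventually.of_forall fun n => hgrow p n)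
  have hi1 : ∀ p, Integrable (fun n => n * h (q p n)) γ := by
    intro p
    refine ((hidn.mul_const |h (q p 0)|).add (hsq.const_mul (L * |c|))).mono'
      (continuous_id.mul (hhq p)).aestronglyMeasurable (Eventually.of_forall fun n => ?_)
    rw [norm_mul, Real.norm_eq_abs, Real.norm_eq_abs]
    have := mul_le_mul_of_nonneg_left (hgrow p n) (abs_nonneg n)
    have h2 : |n| * (L * (|c| * |n|)) = L * |c| * n ^ 2 := by rw [← sq_abs n]; ring
    simp only [Pi.add_apply]
    linarith
  have hkc : ∀ a, Continuous fun x : (ℝ × E) × ℝ => fderiv ℝ h (q x.1 x.2) a := fun a =>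
    (hhc.comp hq).clm_apply continuous_const
  have hkb : ∀ a p, |fderiv ℝ h p a| ≤ L * ‖a‖ := fun a p =>
    (ContinuousLinearMap.le_opNorm _ _).trans (mul_le_mul_of_nonneg_right (hL p) (norm_nonneg _))
  let g : ℝ × E → ℝ := fun p => ∫ n, fderiv ℝ h (q p n) (1, 0) ∂γ
  -- Integration by parts in `n` expresses `g` through `h` instead of `∂₁h`. Hence `g` can be
  -- differentiated under the integral although `h` is only `C¹`.
  have hg1 : ∀ p, ∫ n, n * h (q p n) ∂γ = c * v * g p := by
    intro p
    have hd : ∀ n, HasDerivAt (fun n => h (q p n)) (c * fderiv ℝ h (q p n) (1, 0)) n := by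
      intro n
      have h1 : HasDerivAt (fun n => q p n) (c * 1, 0) n :=
        (((hasDerivAt_id n).const_mul c).const_add _).prodMk (hasDerivAt_const n p.2)
      have h2 := (hhd (q p n)).hasFDerivAt.comp_hasDerivAt n h1
      refine h2.congr_deriv ?_
      have h3 : ((c * 1, 0) : ℝ × E) = c • (1, 0) := by simp
      rw [h3, map_smul, smul_eq_mul]
    rw [integral_id_mul_gaussianReal hv hd (hi0 p) ?_ (hi1 p), integral_const_mul]
    · ring
    · refine Integrable.const_mul ?_ c
      exact Integrable.of_bound
        ((hkc _).comp (Continuous.prodMk_right p)).aestronglyMeasurable _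
        (Eventually.of_forall fun n => hkb _ _)
  let G' : ℝ × E → ℝ → ℝ × E →L[ℝ] ℝ := fun p n => n • (fderiv ℝ h (q p n)).comp T
  have hG'c : Continuous fun x : (ℝ × E) × ℝ => G' x.1 x.2 :=
    continuous_snd.smul ((hhc.comp hq).clm_comp continuous_const)
  have hG'b : ∀ p n, ‖G' p n‖ ≤ L * ‖T‖ * |n| := by
    intro p n
    rw [norm_smul, mul_comm, Real.norm_eq_abs]
    exact mul_le_mul_of_nonneg_right ((ContinuousLinearMap.opNorm_comp_le _ _).trans
      (mul_le_mul_of_nonneg_right (hL _) (norm_nonneg _))) (abs_nonneg _)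
  have hG'm : ∀ p, AEStronglyMeasurable (G' p) γ := fun p =>
    (hG'c.comp (Continuous.prodMk_right p)).aestronglyMeasurable
  have hG'i : ∀ p, Integrable (G' p) γ := fun p =>
    (hidn.const_mul (L * ‖T‖)).mono' (hG'm p) (Eventually.of_forall fun n => hG'b p n)
  have hGd : ∀ p, HasFDerivAt (fun p => ∫ n, n * h (q p n) ∂γ) (∫ n, G' p n ∂γ) p := by
    intro p
    refine hasFDerivAt_integral_of_dominated_of_fderiv_le (bound := fun n => L * ‖T‖ * |n|)
      (F' := G') univ_mem
      (Eventually.of_forall fun p => (hi1 p).1) (hi1 p) (hG'm p)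
      (Eventually.of_forall fun n p _ => hG'b p n) (hidn.const_mul (L * ‖T‖))
      (Eventually.of_forall fun n p _ => ?_)
    exact ((hhd (q p n)).hasFDerivAt.comp p (hqd p n)).const_mul n
  have hGc : Continuous fun p => ∫ n, G' p n ∂γ :=
    continuous_of_dominated hG'm (fun p => Eventually.of_forall fun n => hG'b p n)
      (hidn.const_mul (L * ‖T‖))
      (Eventually.of_forall fun n => hG'c.comp (Continuous.prodMk_left n))
  have hgd : ∀ p, HasFDerivAt g ((c * v)⁻¹ • ∫ n, G' p n ∂γ) p := by
    intro p
    refine ((hGd p).const_mul (c * (v : ℝ))⁻¹).congr_of_eventuallyEq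
      (Eventually.of_forall fun p => ?_)
    simp only [hg1]
    field_simp
  have hgf : ∀ p, fderiv ℝ g p = (c * v)⁻¹ • ∫ n, G' p n ∂γ := fun p => (hgd p).fderiv
  refine ⟨g, max (L * ‖((1, 0) : ℝ × E)‖) (|(c * (v : ℝ))⁻¹| * ∫ n, L * ‖T‖ * |n| ∂γ), ?_, ?_, ?_,
    fun p => rfl, ?_⟩
  · refine contDiff_one_iff_fderiv.2 ⟨fun p => (hgd p).differentiableAt, ?_⟩
    rw [funext hgf]
    exact (continuous_const (y := (c * (v : ℝ))⁻¹)).smul hGc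
  · intro p
    refine le_trans ?_ (le_max_left _ _)
    refine (norm_integral_le_of_norm_le_const (μ := γ) (f := fun n => fderiv ℝ h (q p n) (1, 0))
      (Eventually.of_forall fun n => hkb (1, 0) (q p n))).trans ?_
    simp [γ]
  · intro p
    refine le_trans ?_ (le_max_right _ _)
    rw [hgf, norm_smul, Real.norm_eq_abs]
    exact mul_le_mul_of_nonneg_left (norm_integral_le_of_norm_le (hidn.const_mul (L * ‖T‖))
      (Eventually.of_forall fun n => hG'b p n)) (abs_nonneg _)
  · intro p a
    rw [hgf, _root_.smul_apply, smul_eq_mul, mul_inv_cancel_left₀ (mul_ne_zero hc hv'),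
      ContinuousLinearMap.integral_apply (hG'i p)]
    rfl

end Gaussian

/-! ### Interpolation between `X` and an independent Gaussian -/

section Interpolation

theorem abs_le_of_norm_fderiv_le {V : Type*} [NormedAddCommGroup V] [NormedSpace ℝ V] {h : V → ℝ}
    (hh : Differentiable ℝ h) {L : ℝ} (hL : ∀ p, ‖fderiv ℝ h p‖ ≤ L) (p : V) :
    |h p| ≤ |h 0| + L * ‖p‖ := by
  have h1 := Convex.norm_image_sub_le_of_norm_fderiv_le (𝕜 := ℝ) (f := h) (s := Set.univ)
    (fun x _ => hh x) (fun x _ => hL x) convex_univ (Set.mem_univ 0) (Set.mem_univ p)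
  rw [sub_zero, Real.norm_eq_abs] at h1
  have := abs_sub_abs_le_abs_sub (h p) (h 0)
  linarith

variable {Ω : Type*} [MeasurableSpace Ω] {H : Type*} [NormedAddCommGroup H]
  [InnerProductSpace ℝ H] {W : H → Ω → ℝ} {P : Measure Ω} [IsProbabilityMeasure P] {d : ℕ}
  {v : Ω → H} {X : Ω → ℝ} {DX : Ω → H} {Y : Fin d → Ω → ℝ} {DY : Fin d → Ω → H}

omit [MeasurableSpace Ω] in
theorem pair_eq_sum (X : Ω → ℝ) (Y : Fin d → Ω → ℝ) (ω : Ω) :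
    (X ω, (WithLp.toLp 2 fun j => Y j ω : EuclideanSpace ℝ (Fin d)))
      = X ω • ((1, 0) : ℝ × EuclideanSpace ℝ (Fin d))
        + ∑ j, Y j ω • ((0, EuclideanSpace.single j 1) : ℝ × EuclideanSpace ℝ (Fin d)) := by
  refine Prod.ext ?_ ?_
  · simp [Prod.fst_sum]
  · ext i
    simp [Prod.snd_sum, Pi.single_apply]

omit [IsProbabilityMeasure P] in
theorem integrable_pair (hX : Integrable X P) (hY : ∀ j, Integrable (Y j) P) :
    Integrable (fun ω => (X ω, (WithLp.toLp 2 fun j => Y j ω : EuclideanSpace ℝ (Fin d)))) P := by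
  simp only [pair_eq_sum]
  exact (hX.smul_const _).add (integrable_finsetSum _ fun j _ => (hY j).smul_const _)

theorem IsSkorohodIntegral.integral_mul_comp_pair (hW : ∀ h, Measurable (W h))
    (hX : IsSkorohodIntegral W P v X) (hDX : HasMalliavinDeriv W P X DX)
    (hY : ∀ j, HasMalliavinDeriv W P (Y j) (DY j)) {g : ℝ × EuclideanSpace ℝ (Fin d) → ℝ}
    (hg : ContDiff ℝ 1 g) {C : ℝ} (hC : ∀ x, |g x| ≤ C) (hC' : ∀ x, ‖fderiv ℝ g x‖ ≤ C) :
    ∫ ω, X ω * g (X ω, WithLp.toLp 2 fun j => Y j ω) ∂P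
      = ∫ ω, fderiv ℝ g (X ω, WithLp.toLp 2 fun j => Y j ω) (1, 0) * ⟪v ω, DX ω⟫ ∂P
        + ∑ j, ∫ ω, fderiv ℝ g (X ω, WithLp.toLp 2 fun j => Y j ω)
            (0, EuclideanSpace.single j 1) * ⟪v ω, DY j ω⟫ ∂P := by
  have h := hX.chainDuality hW (Z := fun o : Option (Fin d) => o.elim X Y)
    (DZ := fun o : Option (Fin d) => o.elim DX DY)
    (fun o => by cases o with
      | none => exact hDX
      | some j => exact hY j)
    (fun o => o.elim (1, 0) fun j => (0, EuclideanSpace.single j 1)) hg hC hC'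
  simp only [ChainDuality, Fintype.sum_option, Option.elim] at h
  simp only [pair_eq_sum]
  exact h

/-- Bound for the effect, on the integral of a `C¹` function, of replacing `X` by an independent
Gaussian variable, by interpolation along `sin θ X + cos θ N`. -/
theorem abs_integral_sub_integral_gaussian_le {s2 : ℝ≥0} (hs2 : s2 ≠ 0)
    (hW : ∀ h, Measurable (W h))
    (hX : IsSkorohodIntegral W P v X) (hDX : HasMalliavinDeriv W P X DX)
    (hY : ∀ j, HasMalliavinDeriv W P (Y j) (DY j)) {h : ℝ × EuclideanSpace ℝ (Fin d) → ℝ}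
    (hh : ContDiff ℝ 1 h) {L : ℝ} (hL : ∀ p, ‖fderiv ℝ h p‖ ≤ L)
    (hx : ∀ p, |fderiv ℝ h p (1, 0)| ≤ 1)
    (hy : ∀ p j, |fderiv ℝ h p (0, EuclideanSpace.single j 1)| ≤ 1) :
    |∫ ω, h (X ω, WithLp.toLp 2 fun j => Y j ω) ∂P
        - ∫ z, h (z.2, WithLp.toLp 2 fun j => Y j z.1) ∂P.prod (gaussianReal 0 s2)|
      ≤ ((∫ n, |n| ∂gaussianReal 0 s2) / s2 * (∫ ω, |⟪v ω, DX ω⟫ - s2| ∂P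
          + ∑ j, ∫ ω, |⟪v ω, DY j ω⟫| ∂P)) * (Real.pi / 2) := by
  have hs2' : (0 : ℝ) < s2 := by exact_mod_cast pos_iff_ne_zero.2 hs2
  have hL0 : 0 ≤ L := (norm_nonneg _).trans (hL 0)
  have hhd : Differentiable ℝ h := hh.differentiable (by simp)
  have hhc : Continuous (fderiv ℝ h) := hh.continuous_fderiv (by simp)
  set γ := gaussianReal 0 s2 with hγ
  set m := ∫ n, |n| ∂γ with hm
  have hm0 : 0 ≤ m := integral_nonneg fun n => abs_nonneg n
  set U : Ω → ℝ × EuclideanSpace ℝ (Fin d) := fun ω => (X ω, WithLp.toLp 2 fun j => Y j ω)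
    with hU
  have hUi : Integrable U P := integrable_pair (hX.memLp.integrable (by norm_num))
    fun j => (hY j).memLp.integrable (by norm_num)
  have hid : Integrable (fun n : ℝ => |n|) γ := (integrable_id_gaussianReal 0 s2).abs
  let q : ℝ → (ℝ × EuclideanSpace ℝ (Fin d)) × ℝ → ℝ × EuclideanSpace ℝ (Fin d) :=
    fun θ x => (Real.sin θ * x.1.1 + Real.cos θ * x.2, x.1.2)
  have hq : ∀ θ, Continuous (q θ) := fun θ => by fun_prop
  have hlin : ∀ a b θ, |Real.sin θ * a + Real.cos θ * b| ≤ |a| + |b| := by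
    intro a b θ
    refine (abs_add_le _ _).trans ?_
    rw [abs_mul, abs_mul]
    exact add_le_add (mul_le_of_le_one_left (abs_nonneg _) (Real.abs_sin_le_one θ))
      (mul_le_of_le_one_left (abs_nonneg _) (Real.abs_cos_le_one θ))
  have hqb : ∀ θ x, ‖q θ x‖ ≤ ‖x.1‖ + |x.2| := by
    intro θ x
    refine max_le ?_ ?_
    · have h1 : |x.1.1| ≤ ‖x.1‖ := norm_fst_le x.1
      exact (hlin _ _ _).trans (by linarith)
    · have h1 : ‖x.1.2‖ ≤ ‖x.1‖ := norm_snd_le x.1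
      exact h1.trans (le_add_of_nonneg_right (abs_nonneg _))
  have hpm : AEStronglyMeasurable (fun z : Ω × ℝ => (U z.1, z.2)) (P.prod γ) :=
    hUi.1.comp_fst.prodMk measurable_snd.aestronglyMeasurable
  have hbi : Integrable (fun z : Ω × ℝ => ‖U z.1‖ + |z.2|) (P.prod γ) :=
    (hUi.norm.comp_fst γ).add (hid.comp_snd P)
  let Φ : ℝ → Ω × ℝ → ℝ := fun θ z => h (q θ (U z.1, z.2))
  let Φ' : ℝ → Ω × ℝ → ℝ := fun θ z =>
    fderiv ℝ h (q θ (U z.1, z.2)) (1, 0) * (Real.cos θ * X z.1 - Real.sin θ * z.2)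
  have hΦm : ∀ θ, AEStronglyMeasurable (Φ θ) (P.prod γ) := fun θ =>
    (hh.continuous.comp (hq θ)).comp_aestronglyMeasurable hpm
  have hΦ'm : ∀ θ, AEStronglyMeasurable (Φ' θ) (P.prod γ) := fun θ =>
    Continuous.comp_aestronglyMeasurable
      (g := fun x : (ℝ × EuclideanSpace ℝ (Fin d)) × ℝ =>
        fderiv ℝ h (q θ x) (1, 0) * (Real.cos θ * x.1.1 - Real.sin θ * x.2))
      (((hhc.comp (hq θ)).clm_apply continuous_const).mul (by fun_prop)) hpm
  have hΦi : ∀ θ, Integrable (Φ θ) (P.prod γ) := fun θ =>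
    ((integrable_const |h 0|).add (hbi.const_mul L)).mono' (hΦm θ) (Eventually.of_forall fun z =>
      (abs_le_of_norm_fderiv_le hhd hL _).trans
        (add_le_add le_rfl (mul_le_mul_of_nonneg_left (hqb _ _) hL0)))
  have hΦ'b : ∀ θ z, ‖Φ' θ z‖ ≤ ‖U z.1‖ + |z.2| := by
    intro θ z
    rw [norm_mul, Real.norm_eq_abs, Real.norm_eq_abs]
    refine (mul_le_of_le_one_left (abs_nonneg _) (hx _)).trans ?_
    have h1 : |X z.1| ≤ ‖U z.1‖ := norm_fst_le (U z.1)
    have h2 := hlin (-z.2) (X z.1) θ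
    rw [abs_neg] at h2
    rw [show Real.cos θ * X z.1 - Real.sin θ * z.2 = Real.sin θ * -z.2 + Real.cos θ * X z.1 by
      ring]
    linarith
  have hΦd : ∀ z θ, HasDerivAt (fun θ => Φ θ z) (Φ' θ z) θ := by
    intro z θ
    have h1 : HasDerivAt (fun θ => q θ (U z.1, z.2))
        (Real.cos θ * X z.1 + -Real.sin θ * z.2, 0) θ :=
      (((Real.hasDerivAt_sin θ).mul_const _).add ((Real.hasDerivAt_cos θ).mul_const _)).prodMk
        (hasDerivAt_const θ _)
    have h2 := (hhd (q θ (U z.1, z.2))).hasFDerivAt.comp_hasDerivAt θ h1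
    refine h2.congr_deriv ?_
    have h3 : ((Real.cos θ * X z.1 + -Real.sin θ * z.2, 0) : ℝ × EuclideanSpace ℝ (Fin d))
        = (Real.cos θ * X z.1 - Real.sin θ * z.2) • (1, 0) := by
      simp [sub_eq_add_neg]
    rw [h3, map_smul, smul_eq_mul, mul_comm]
  have hφ : ∀ θ, Integrable (Φ' θ) (P.prod γ) ∧
      HasDerivAt (fun θ => ∫ z, Φ θ z ∂P.prod γ) (∫ z, Φ' θ z ∂P.prod γ) θ := fun θ =>
    hasDerivAt_integral_of_dominated_loc_of_deriv_le univ_mem (Eventually.of_forall hΦm) (hΦi θ)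
      (hΦ'm θ) (Eventually.of_forall fun z θ _ => hΦ'b θ z) hbi
      (Eventually.of_forall fun z θ _ => hΦd z θ)
  -- The endpoint `π/2` is excluded because smoothing needs `cos θ ≠ 0`; the mean value inequality
  -- below only needs the half-open interval.
  have hbound : ∀ θ ∈ Set.Ico 0 (Real.pi / 2), ‖∫ z, Φ' θ z ∂P.prod γ‖
      ≤ m / s2 * (∫ ω, |⟪v ω, DX ω⟫ - s2| ∂P + ∑ j, ∫ ω, |⟪v ω, DY j ω⟫| ∂P) := by
    intro θ hθ
    have hc : 0 < Real.cos θ := Real.cos_pos_of_mem_Ioo ⟨by linarith [hθ.1, Real.pi_pos], hθ.2⟩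
    set c := Real.cos θ with hcdef
    set s := Real.sin θ with hsdef
    have hs : |s| ≤ 1 := Real.abs_sin_le_one θ
    obtain ⟨g, C, hg, hgC, hgC', hg1, hg2⟩ := exists_gaussian_smoothing hs2 hh hL s hc.ne'
    -- The factor `c` absorbs the `1/c` in the derivative of the smoothed function, which makes the
    -- bound uniform in `θ`.
    have hgb : ∀ a : ℝ × EuclideanSpace ℝ (Fin d), (∀ p, |fderiv ℝ h p (s * a.1, a.2)| ≤ 1) →
        ∀ p, |c * fderiv ℝ g p a| ≤ m / s2 := by
      intro a ha p
      rw [le_div_iff₀ hs2']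
      have h1 : |c * fderiv ℝ g p a| * s2 = |c * s2 * fderiv ℝ g p a| := by
        rw [abs_mul, abs_mul, abs_mul, abs_of_pos hs2']
        ring
      rw [h1, hg2, ← Real.norm_eq_abs]
      refine norm_integral_le_of_norm_le hid (Eventually.of_forall fun n => ?_)
      rw [norm_mul, Real.norm_eq_abs, Real.norm_eq_abs]
      exact mul_le_of_le_one_right (abs_nonneg _) (ha _)
    have hsx : ∀ p, fderiv ℝ h p (s * 1, 0) = s * fderiv ℝ h p (1, 0) := by
      intro p
      rw [← smul_eq_mul s (fderiv ℝ h p (1, 0)), ← map_smul]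
      simp
    have hgx : ∀ p, |c * fderiv ℝ g p (1, 0)| ≤ m / s2 := by
      refine hgb _ fun p => ?_
      rw [hsx, abs_mul]
      exact mul_le_one₀ hs (abs_nonneg _) (hx p)
    have hgy : ∀ j p, |c * fderiv ℝ g p (0, EuclideanSpace.single j 1)| ≤ m / s2 := fun j =>
      hgb _ fun p => by simpa using hy p j
    have hkc : ∀ p : ℝ × EuclideanSpace ℝ (Fin d),
        Continuous fun n => fderiv ℝ h (s * p.1 + c * n, p.2) (1, 0) := fun p =>
      (hhc.comp (by fun_prop)).clm_apply continuous_const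
    -- Integrating out the Gaussian variable leaves `X g(U)`, ready for duality, and a term in `∂ₓg`
    -- obtained from `hg2` in the direction `(1, 0)`.
    have hinner : ∀ ω, ∫ n, Φ' θ (ω, n) ∂γ
        = c * (X ω * g (U ω)) - c * s2 * fderiv ℝ g (U ω) (1, 0) := by
      intro ω
      have e1 : ∀ n, Φ' θ (ω, n) = c * X ω * fderiv ℝ h (s * (U ω).1 + c * n, (U ω).2) (1, 0)
          - n * fderiv ℝ h (s * (U ω).1 + c * n, (U ω).2) (s * 1, 0) := by
        intro n
        rw [hsx]
        simp only [Φ', q]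
        ring
      rw [hg2, hg1]
      simp only [e1]
      rw [integral_sub, integral_const_mul, mul_assoc]
      · exact (Integrable.of_bound (hkc _).aestronglyMeasurable 1
          (Eventually.of_forall fun n => hx _)).const_mul _
      · simp only [hsx]
        refine hid.mono' ((continuous_id.mul (continuous_const.mul
          (hkc _))).aestronglyMeasurable) (Eventually.of_forall fun n => ?_)
        rw [norm_mul, norm_mul, Real.norm_eq_abs, Real.norm_eq_abs, Real.norm_eq_abs]
        exact mul_le_of_le_one_right (abs_nonneg _) (mul_le_one₀ hs (abs_nonneg _) (hx _))
    have hgc : ∀ a, AEStronglyMeasurable (fun ω => fderiv ℝ g (U ω) a) P := fun a =>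
      ((hg.continuous_fderiv (by simp)).clm_apply continuous_const).comp_aestronglyMeasurable
        hUi.1
    have hgf : ∀ a p, ‖fderiv ℝ g p a‖ ≤ C * ‖a‖ := fun a p =>
      (ContinuousLinearMap.le_opNorm _ _).trans
        (mul_le_mul_of_nonneg_right (hgC' p) (norm_nonneg _))
    have hTx := integrable_inner_of_memLp hX.memLp_integrand hDX.memLp_deriv
    have hgi : ∀ a, Integrable (fun ω => fderiv ℝ g (U ω) a) P := fun a =>
      Integrable.of_bound (hgc a) (C * ‖a‖) (Eventually.of_forall fun ω => hgf a _)
    have hXg : Integrable (fun ω => X ω * g (U ω)) P :=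
      (hX.memLp.integrable (by norm_num)).mul_bdd (c := C)
        (hg.continuous.comp_aestronglyMeasurable hUi.1) (Eventually.of_forall fun ω => hgC _)
    have hdual := hX.integral_mul_comp_pair hW hDX hY hg hgC hgC'
    have hsplit : ∫ ω, fderiv ℝ g (U ω) (1, 0) * ⟪v ω, DX ω⟫ ∂P
        - s2 * ∫ ω, fderiv ℝ g (U ω) (1, 0) ∂P
        = ∫ ω, fderiv ℝ g (U ω) (1, 0) * (⟪v ω, DX ω⟫ - s2) ∂P := by
      rw [← integral_const_mul, ← integral_sub]
      · refine integral_congr_ae (Eventually.of_forall fun ω => ?_)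
        simp only
        ring
      · exact hTx.bdd_mul (hgc _) (Eventually.of_forall fun ω => hgf _ _)
      · exact (hgi _).const_mul _
    have hmain : ∫ z, Φ' θ z ∂P.prod γ
        = c * ∫ ω, fderiv ℝ g (U ω) (1, 0) * (⟪v ω, DX ω⟫ - s2) ∂P
          + ∑ j, c * ∫ ω, fderiv ℝ g (U ω) (0, EuclideanSpace.single j 1) * ⟪v ω, DY j ω⟫ ∂P := by
      rw [integral_prod _ (hφ θ).1]
      simp only [hinner]
      rw [integral_sub (hXg.const_mul c) ((hgi _).const_mul _), integral_const_mul,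
        integral_const_mul, hdual, ← hsplit, ← Finset.mul_sum]
      ring
    have hterm : ∀ (a : ℝ × EuclideanSpace ℝ (Fin d)) (T : Ω → ℝ), Integrable T P →
        (∀ p, |c * fderiv ℝ g p a| ≤ m / s2) →
        |c * ∫ ω, fderiv ℝ g (U ω) a * T ω ∂P| ≤ m / s2 * ∫ ω, |T ω| ∂P := by
      intro a T hT ha
      rw [← integral_const_mul, ← integral_const_mul, ← Real.norm_eq_abs]
      refine norm_integral_le_of_norm_le (hT.abs.const_mul _) (Eventually.of_forall fun ω => ?_)
      rw [← mul_assoc, norm_mul]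
      exact mul_le_mul_of_nonneg_right (ha _) (norm_nonneg _)
    rw [hmain, mul_add, Finset.mul_sum, Real.norm_eq_abs]
    refine (abs_add_le _ _).trans (add_le_add ?_ ?_)
    · exact hterm _ _ (hTx.sub (integrable_const _)) hgx
    · refine (Finset.abs_sum_le_sum_abs _ _).trans (Finset.sum_le_sum fun j _ => ?_)
      exact hterm _ _ (integrable_inner_of_memLp hX.memLp_integrand (hY j).memLp_deriv) (hgy j)
  have hmv := norm_image_sub_le_of_norm_deriv_le_segment'
    (f := fun θ => ∫ z, Φ θ z ∂P.prod γ) (a := 0) (b := Real.pi / 2)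
    (fun θ _ => (hφ θ).2.hasDerivWithinAt) hbound (Real.pi / 2)
    (Set.right_mem_Icc.2 (by positivity))
  have h0 : ∫ z, Φ 0 z ∂P.prod γ
      = ∫ z, h (z.2, WithLp.toLp 2 fun j => Y j z.1) ∂P.prod γ := by
    simp [Φ, q, hU]
  have h1 : ∫ z, Φ (Real.pi / 2) z ∂P.prod γ = ∫ ω, h (U ω) ∂P := by
    have e : ∀ z, Φ (Real.pi / 2) z = h (U z.1) := fun z => by simp [Φ, q]
    simp only [e]
    rw [integral_fun_fst (μ := P) (ν := γ) (fun ω => h (U ω))]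
    simp
  simp only [h0, h1, sub_zero, Real.norm_eq_abs] at hmv
  exact hmv

end Interpolation

/-! ### Lipschitz test functions and the two laws -/

section Wasserstein

variable {d : ℕ} {h : ℝ × EuclideanSpace ℝ (Fin d) → ℝ}

/-- The norm on the product type is the maximum norm, which costs a factor `√2` against the
Euclidean one; `2` is a convenient upper bound. -/
theorem LipOne.lipschitzWith (hh : LipOne h) : LipschitzWith 2 h := by
  refine LipschitzWith.of_dist_le_mul fun p q => ?_
  rw [Real.dist_eq, dist_eq_norm]
  refine (hh p q).trans (Real.sqrt_le_iff.2 ⟨by positivity, ?_⟩)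
  have h1 : |p.1 - q.1| ≤ ‖p - q‖ := norm_fst_le (p - q)
  have h2 : ‖p.2 - q.2‖ ≤ ‖p - q‖ := norm_snd_le (p - q)
  rw [← sq_abs (p.1 - q.1)]
  have h3 := pow_le_pow_left₀ (abs_nonneg _) h1 2
  have h4 := pow_le_pow_left₀ (norm_nonneg _) h2 2
  push_cast
  nlinarith [sq_nonneg ‖p - q‖]

/-- Along a line in a Euclidean unit direction `h` is 1-Lipschitz. Working by directions keeps the
constant `1`, which the operator norm for the maximum norm would lose. -/
theorem LipOne.abs_fderiv_le (hh : LipOne h) (hd : Differentiable ℝ h)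
    {a : ℝ × EuclideanSpace ℝ (Fin d)} (ha : a.1 ^ 2 + ‖a.2‖ ^ 2 = 1)
    (p : ℝ × EuclideanSpace ℝ (Fin d)) : |fderiv ℝ h p a| ≤ 1 := by
  have h1 : HasDerivAt (fun t : ℝ => p + t • a) a 0 := by
    simpa using ((hasDerivAt_id (0 : ℝ)).smul_const a).const_add p
  have h2 : HasDerivAt (fun t : ℝ => h (p + t • a)) (fderiv ℝ h p a) 0 := by
    have h3 : HasFDerivAt h (fderiv ℝ h p) (p + (0 : ℝ) • a) := by
      simpa using (hd p).hasFDerivAt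
    exact h3.comp_hasDerivAt 0 h1
  have h3 : LipschitzWith 1 fun t : ℝ => h (p + t • a) := by
    refine LipschitzWith.of_dist_le_mul fun t u => ?_
    rw [Real.dist_eq, Real.dist_eq]
    refine (hh _ _).trans (Real.sqrt_le_iff.2 ⟨by positivity, le_of_eq ?_⟩)
    have e1 : (p + t • a).1 - (p + u • a).1 = (t - u) * a.1 := by
      simp
      ring
    have e2 : (p + t • a).2 - (p + u • a).2 = (t - u) • a.2 := by
      simp [sub_smul]
    rw [e1, e2, norm_smul, mul_pow, mul_pow, Real.norm_eq_abs, sq_abs, ← mul_add, ha]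
    simp
  have h4 := norm_deriv_le_of_lipschitz h3 (x₀ := 0)
  rwa [h2.deriv, Real.norm_eq_abs] at h4

theorem LipOne.integrable (hh : LipOne h) {μ : Measure (ℝ × EuclideanSpace ℝ (Fin d))}
    [IsFiniteMeasure μ] (hμ : Integrable (fun p => p) μ) : Integrable h μ := by
  refine ((integrable_const |h 0|).add (hμ.norm.const_mul 2)).mono'
    hh.lipschitzWith.continuous.aestronglyMeasurable (Eventually.of_forall fun p => ?_)
  have h1 := hh.lipschitzWith.dist_le_mul p 0
  rw [Real.dist_eq, dist_zero_right] at h1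
  have h2 := abs_sub_abs_le_abs_sub (h p) (h 0)
  simp only [Pi.add_apply, Real.norm_eq_abs]
  push_cast at h1
  linarith

open scoped Convolution in
/-- Functions in `Lip(1)` are uniform limits of `C¹` functions in `Lip(1)`. -/
theorem LipOne.exists_contDiff_approx (hh : LipOne h) {ε : ℝ} (hε : 0 < ε) :
    ∃ k : ℝ × EuclideanSpace ℝ (Fin d) → ℝ, LipOne k ∧ ContDiff ℝ 1 k ∧ ∀ p, |k p - h p| ≤ ε := by
  have hc : Continuous h := hh.lipschitzWith.continuous
  let μ : Measure (ℝ × EuclideanSpace ℝ (Fin d)) := Measure.addHaar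
  -- Outer radius `ε / 2` and Lipschitz constant `2` give a uniform error of at most `ε`.
  let φ : ContDiffBump (0 : ℝ × EuclideanSpace ℝ (Fin d)) :=
    ⟨ε / 4, ε / 2, by positivity, by linarith⟩
  have hi : ∀ p, Integrable (fun t => φ.normed μ t * h (p - t)) μ := fun p =>
    (φ.continuous_normed.mul (hc.comp (by fun_prop))).integrable_of_hasCompactSupport
      φ.hasCompactSupport_normed.mul_right
  refine ⟨φ.normed μ ⋆[ContinuousLinearMap.lsmul ℝ ℝ, μ] h, fun p q => ?_, ?_, fun p => ?_⟩
  · have e : ∀ p, (φ.normed μ ⋆[ContinuousLinearMap.lsmul ℝ ℝ, μ] h) p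
        = ∫ t, φ.normed μ t * h (p - t) ∂μ := fun p => rfl
    rw [e, e, ← integral_sub (hi p) (hi q), ← Real.norm_eq_abs]
    have h1 : ∫ t, φ.normed μ t * Real.sqrt ((p.1 - q.1) ^ 2 + ‖p.2 - q.2‖ ^ 2) ∂μ
        = Real.sqrt ((p.1 - q.1) ^ 2 + ‖p.2 - q.2‖ ^ 2) := by
      rw [integral_mul_const, φ.integral_normed, one_mul]
    refine (norm_integral_le_of_norm_le (φ.integrable_normed.mul_const _)
      (Eventually.of_forall fun t => ?_)).trans_eq h1
    rw [← mul_sub, norm_mul, Real.norm_eq_abs, Real.norm_eq_abs, abs_of_nonneg (φ.nonneg_normed t)]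
    refine mul_le_mul_of_nonneg_left ?_ (φ.nonneg_normed t)
    have h2 := hh (p - t) (q - t)
    simpa using h2
  · exact φ.hasCompactSupport_normed.contDiff_convolution_left _ φ.contDiff_normed
      hc.locallyIntegrable
  · rw [← Real.dist_eq]
    refine φ.dist_normed_convolution_le hc.aestronglyMeasurable fun x hx => ?_
    have h1 := hh.lipschitzWith.dist_le_mul x p
    have h2 : dist x p < ε / 2 := hx
    push_cast at h1
    linarith

variable {Ω : Type*} [MeasurableSpace Ω] {P : Measure Ω} [IsProbabilityMeasure P]
  {Y : Ω → EuclideanSpace ℝ (Fin d)} {γ : Measure ℝ} [IsProbabilityMeasure γ]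

theorem integrable_id_prod_map (hγ : Integrable (fun n => n) γ) (hY : Integrable Y P) :
    Integrable (fun p => p) (γ.prod (P.map Y)) := by
  have : IsProbabilityMeasure (P.map Y) := Measure.isProbabilityMeasure_map hY.1.aemeasurable
  have h1 : Integrable (fun y => y) (P.map Y) :=
    (integrable_map_measure continuous_id.aestronglyMeasurable hY.1.aemeasurable).2 hY
  exact (hγ.comp_fst (P.map Y)).prodMk (h1.comp_snd γ)

theorem LipOne.integral_prod_map (hh : LipOne h) (hγ : Integrable (fun n => n) γ)
    (hY : Integrable Y P) :
    ∫ p, h p ∂γ.prod (P.map Y) = ∫ z, h (z.2, Y z.1) ∂P.prod γ := by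
  have : IsProbabilityMeasure (P.map Y) := Measure.isProbabilityMeasure_map hY.1.aemeasurable
  have hc : Continuous h := hh.lipschitzWith.continuous
  have h1 : Integrable (fun z : Ω × ℝ => (z.2, Y z.1)) (P.prod γ) :=
    (hγ.comp_snd P).prodMk (hY.comp_fst γ)
  have : IsProbabilityMeasure ((P.prod γ).map fun z : Ω × ℝ => (z.2, Y z.1)) :=
    Measure.isProbabilityMeasure_map h1.1.aemeasurable
  have h2 : Integrable (fun z : Ω × ℝ => h (z.2, Y z.1)) (P.prod γ) :=
    (integrable_map_measure hc.aestronglyMeasurable h1.1.aemeasurable).1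
      (hh.integrable ((integrable_map_measure continuous_id.aestronglyMeasurable
        h1.1.aemeasurable).2 h1))
  rw [integral_prod _ (hh.integrable (integrable_id_prod_map hγ hY)), integral_prod_symm _ h2]
  refine integral_congr_ae (Eventually.of_forall fun n => ?_)
  exact integral_map hY.1.aemeasurable
    (hc.comp (Continuous.prodMk_right n)).aestronglyMeasurable

theorem abs_integral_sub_le_of_abs_sub_le {α : Type*} [MeasurableSpace α] {μ : Measure α}
    [IsProbabilityMeasure μ] {f g : α → ℝ} (hf : Integrable f μ) (hg : Integrable g μ) {ε : ℝ}
    (h : ∀ x, |f x - g x| ≤ ε) : |∫ x, f x ∂μ - ∫ x, g x ∂μ| ≤ ε := by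
  rw [← integral_sub hf hg, ← Real.norm_eq_abs]
  simpa using norm_integral_le_of_norm_le_const (μ := μ) (f := fun x => f x - g x)
    (Eventually.of_forall h)

omit [IsProbabilityMeasure P] in
theorem lintegral_enorm_sq_eq (T : Ω → ℝ) :
    ∫⁻ ω, ‖T ω‖ₑ ^ 2 ∂P = ∫⁻ ω, ENNReal.ofReal (T ω ^ 2) ∂P := by
  refine lintegral_congr fun ω => ?_
  rw [Real.enorm_eq_ofReal_abs, ← ENNReal.ofReal_pow (abs_nonneg _), sq_abs]

/-- The right-hand side is a Lebesgue integral in `ℝ≥0∞`, so the inequality also covers an infinite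
second moment. -/
theorem ofReal_integral_abs_le {T : Ω → ℝ} (hT : AEStronglyMeasurable T P) :
    ENNReal.ofReal (∫ ω, |T ω| ∂P) ≤ (∫⁻ ω, ENNReal.ofReal (T ω ^ 2) ∂P) ^ (1 / 2 : ℝ) := by
  have h1 := eLpNorm_le_eLpNorm_of_exponent_le (p := 1) (q := 2) (by norm_num) hT
  have h2 : eLpNorm T 2 P = (∫⁻ ω, ENNReal.ofReal (T ω ^ 2) ∂P) ^ (1 / 2 : ℝ) := by
    rw [← lintegral_enorm_sq_eq, eLpNorm_eq_lintegral_rpow_enorm_toReal (by norm_num) (by norm_num)]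
    simp
  rw [h2, eLpNorm_one_eq_lintegral_enorm] at h1
  refine le_trans ?_ h1
  have h3 : ∫ ω, |T ω| ∂P = (∫⁻ ω, ‖T ω‖ₑ ∂P).toReal := integral_norm_eq_lintegral_enorm hT
  rw [h3]
  exact ENNReal.ofReal_toReal_le

variable {H : Type*} [NormedAddCommGroup H] [InnerProductSpace ℝ H] {W : H → Ω → ℝ}
  {v : Ω → H} {X : Ω → ℝ} {DX : Ω → H} {Z : Fin d → Ω → ℝ} {DZ : Fin d → Ω → H}

/-- The bound for `C¹` functions does not depend on their derivative bound `L`, so it survives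
uniform approximation: an error `ε / 2` under each law costs `ε` in total. -/
theorem LipOne.abs_integral_sub_integral_gaussian_le (hh : LipOne h) {s2 : ℝ≥0} (hs2 : s2 ≠ 0)
    (hW : ∀ h, Measurable (W h))
    (hX : IsSkorohodIntegral W P v X) (hDX : HasMalliavinDeriv W P X DX)
    (hZ : ∀ j, HasMalliavinDeriv W P (Z j) (DZ j)) :
    |∫ p, h p ∂(P.map fun ω => (X ω, (WithLp.toLp 2 fun j => Z j ω : EuclideanSpace ℝ (Fin d))))
        - ∫ p, h p ∂((gaussianReal 0 s2).prod
            (P.map fun ω => (WithLp.toLp 2 fun j => Z j ω : EuclideanSpace ℝ (Fin d))))|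
      ≤ ((∫ n, |n| ∂gaussianReal 0 s2) / s2 * (∫ ω, |⟪v ω, DX ω⟫ - s2| ∂P
          + ∑ j, ∫ ω, |⟪v ω, DZ j ω⟫| ∂P)) * (Real.pi / 2) := by
  have hUi : Integrable (fun ω =>
      (X ω, (WithLp.toLp 2 fun j => Z j ω : EuclideanSpace ℝ (Fin d)))) P :=
    integrable_pair (hX.memLp.integrable (by norm_num))
      fun j => (hZ j).memLp.integrable (by norm_num)
  have hYi : Integrable (fun ω => (WithLp.toLp 2 fun j => Z j ω : EuclideanSpace ℝ (Fin d))) P :=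
    hUi.snd
  have hγ : Integrable (fun n => n) (gaussianReal 0 s2) := integrable_id_gaussianReal 0 s2
  set μ := P.map fun ω => (X ω, (WithLp.toLp 2 fun j => Z j ω : EuclideanSpace ℝ (Fin d)))
  set ν := (gaussianReal 0 s2).prod
    (P.map fun ω => (WithLp.toLp 2 fun j => Z j ω : EuclideanSpace ℝ (Fin d))) with hν
  have : IsProbabilityMeasure μ := Measure.isProbabilityMeasure_map hUi.1.aemeasurable
  have : IsProbabilityMeasure
      (P.map fun ω => (WithLp.toLp 2 fun j => Z j ω : EuclideanSpace ℝ (Fin d))) :=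
    Measure.isProbabilityMeasure_map hYi.1.aemeasurable
  have hμi : Integrable (fun p => p) μ :=
    (integrable_map_measure continuous_id.aestronglyMeasurable hUi.1.aemeasurable).2 hUi
  have hνi : Integrable (fun p => p) ν := integrable_id_prod_map hγ hYi
  refine le_of_forall_pos_le_add fun ε hε => ?_
  obtain ⟨k, hk, hkd, hkh⟩ := hh.exists_contDiff_approx (half_pos hε)
  have hkdiff : Differentiable ℝ k := hkd.differentiable (by simp)
  have hb := SteinMalliavin.abs_integral_sub_integral_gaussian_le hs2 hW hX hDX hZ hkd
    (fun p => norm_fderiv_le_of_lipschitz ℝ hk.lipschitzWith)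
    (fun p => hk.abs_fderiv_le hkdiff (by simp) p)
    (fun p j => hk.abs_fderiv_le hkdiff (by simp) p)
  rw [← hk.integral_prod_map hγ hYi, ← hν,
    ← integral_map (φ := fun ω =>
        (X ω, (WithLp.toLp 2 fun j => Z j ω : EuclideanSpace ℝ (Fin d))))
      hUi.1.aemeasurable hkd.continuous.aestronglyMeasurable] at hb
  have h1 := abs_integral_sub_le_of_abs_sub_le (hk.integrable hμi) (hh.integrable hμi) hkh
  have h2 := abs_integral_sub_le_of_abs_sub_le (hk.integrable hνi) (hh.integrable hνi) hkh
  rw [abs_le] at h1 h2 hb ⊢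
  constructor <;> linarith [h1.1, h1.2, h2.1, h2.2, hb.1, hb.2]

theorem LipOne.integral_eq_of_ae_eq_zero (hh : LipOne h) (hX0 : X =ᵐ[P] 0)
    (hY : Integrable Y P) :
    ∫ p, h p ∂(P.map fun ω => (X ω, Y ω)) = ∫ p, h p ∂((gaussianReal 0 0).prod (P.map Y)) := by
  have hc : Continuous h := hh.lipschitzWith.continuous
  have hU : AEMeasurable (fun ω => (X ω, Y ω)) P :=
    (aemeasurable_const.congr hX0.symm : AEMeasurable X P).prodMk hY.1.aemeasurable
  rw [integral_map hU hc.aestronglyMeasurable,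
    hh.integral_prod_map (integrable_id_gaussianReal 0 0) hY, gaussianReal_zero_var,
    Measure.prod_dirac, integral_map (by fun_prop)]
  · refine integral_congr_ae ?_
    filter_upwards [hX0] with ω hω
    simp [hω]
  · rw [← Measure.prod_dirac]
    exact hc.comp_aestronglyMeasurable
      (measurable_snd.aestronglyMeasurable.prodMk hY.1.comp_fst)

end Wasserstein

end SteinMalliavin

theorem proposition3p2 (σ : ℝ≥0) :
    ∃ C : ℝ≥0, 0 < C ∧
      ∀ (Ω : Type*) [MeasurableSpace Ω] (P : Measure Ω) [IsProbabilityMeasure P]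
        (H : Type*) [NormedAddCommGroup H] [InnerProductSpace ℝ H] [CompleteSpace H]
        (W : H → Ω → ℝ) (_ : SteinMalliavin.IsIsonormal W P)
        (d : ℕ) (v : Ω → H) (X : Ω → ℝ) (DX : Ω → H)
        (Y : Fin d → Ω → ℝ) (DY : Fin d → Ω → H),
        SteinMalliavin.IsSkorohodIntegral W P v X →
        SteinMalliavin.HasMalliavinDeriv W P X DX →
        (∀ j, SteinMalliavin.HasMalliavinDeriv W P (Y j) (DY j)) →
        ∫ ω, X ω ^ 2 ∂P = (σ : ℝ) ^ 2 →
        SteinMalliavin.wassersteinDist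
            (P.map fun ω => (X ω, (WithLp.toLp 2 fun j => Y j ω : EuclideanSpace ℝ (Fin d))))
            ((gaussianReal 0 (σ ^ 2)).prod
              (P.map fun ω => (WithLp.toLp 2 fun j => Y j ω : EuclideanSpace ℝ (Fin d))))
          ≤ C * ((evariance (fun ω => ⟪DX ω, v ω⟫) P) ^ (1 / 2 : ℝ)
              + ∑ j, (∫⁻ ω, ENNReal.ofReal (⟪v ω, DY j ω⟫ ^ 2) ∂P) ^ (1 / 2 : ℝ)) := by
  set K : ℝ := (∫ n, |n| ∂gaussianReal 0 (σ ^ 2)) / ((σ ^ 2 : ℝ≥0) : ℝ) * (Real.pi / 2) with hK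
  have hK0 : 0 ≤ K := mul_nonneg (div_nonneg (integral_nonneg fun n => abs_nonneg n)
    (NNReal.coe_nonneg _)) (by positivity)
  -- Adding `1` keeps the constant positive when `σ = 0`, where division by zero makes `K = 0`.
  refine ⟨K.toNNReal + 1, by positivity, ?_⟩
  intro Ω _ P _ H _ _ _ W hWiso d v X DX Y DY hX hDX hY hvar
  have hW := hWiso.measurable
  have hUi : Integrable (fun ω =>
      (X ω, (WithLp.toLp 2 fun j => Y j ω : EuclideanSpace ℝ (Fin d)))) P :=
    SteinMalliavin.integrable_pair (hX.memLp.integrable (by norm_num))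
      fun j => (hY j).memLp.integrable (by norm_num)
  have hYi : Integrable (fun ω => (WithLp.toLp 2 fun j => Y j ω : EuclideanSpace ℝ (Fin d))) P :=
    hUi.snd
  have : IsProbabilityMeasure (P.map fun ω =>
      (X ω, (WithLp.toLp 2 fun j => Y j ω : EuclideanSpace ℝ (Fin d)))) :=
    Measure.isProbabilityMeasure_map hUi.1.aemeasurable
  have : IsProbabilityMeasure
      (P.map fun ω => (WithLp.toLp 2 fun j => Y j ω : EuclideanSpace ℝ (Fin d))) :=
    Measure.isProbabilityMeasure_map hYi.1.aemeasurable
  refine iSup₂_le fun h hh => ?_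
  -- Both laws have a finite first moment, so the value `∞` in `wassersteinDist` never occurs.
  rw [if_pos ⟨hh.integrable ((integrable_map_measure continuous_id.aestronglyMeasurable
      hUi.1.aemeasurable).2 hUi), hh.integrable (SteinMalliavin.integrable_id_prod_map
      (SteinMalliavin.integrable_id_gaussianReal 0 _) hYi)⟩]
  rcases eq_or_ne σ 0 with rfl | hσ
  · have hX0 : X =ᵐ[P] 0 := by
      have h1 : (fun ω => X ω ^ 2) =ᵐ[P] 0 :=
        (integral_eq_zero_iff_of_nonneg (fun ω => sq_nonneg _) hX.memLp.integrable_sq).1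
          (by simpa using hvar)
      filter_upwards [h1] with ω hω
      simpa using hω
    have h2 := hh.integral_eq_of_ae_eq_zero hX0 hYi
    rw [← show ((0 : ℝ≥0) ^ 2) = 0 by simp] at h2
    rw [h2]
    simp
  · have hb := hh.abs_integral_sub_integral_gaussian_le (pow_ne_zero 2 hσ) hW hX hDX hY
    -- Duality tested on `F = X` identifies the mean, so the deviation from `σ²` is the deviation
    -- measured by the variance.
    have hmean : ∫ ω, ⟪DX ω, v ω⟫ ∂P = ((σ ^ 2 : ℝ≥0) : ℝ) := by
      have h1 := hX.duality X DX hDX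
      simp only [← pow_two] at h1
      simp only [real_inner_comm (v _)]
      rw [← h1, hvar]
      simp
    have hTx := SteinMalliavin.integrable_inner_of_memLp hX.memLp_integrand hDX.memLp_deriv
    have hvarX : ENNReal.ofReal (∫ ω, |⟪v ω, DX ω⟫ - ((σ ^ 2 : ℝ≥0) : ℝ)| ∂P)
        ≤ (evariance (fun ω => ⟪DX ω, v ω⟫) P) ^ (1 / 2 : ℝ) := by
      refine (SteinMalliavin.ofReal_integral_abs_le
        (hTx.sub (integrable_const _)).1).trans_eq ?_
      rw [evariance, hmean, SteinMalliavin.lintegral_enorm_sq_eq]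
      simp only [real_inner_comm (v _), Pi.sub_apply]
    have hsum0 : 0 ≤ ∑ j, ∫ ω, |⟪v ω, DY j ω⟫| ∂P :=
      Finset.sum_nonneg fun j _ => integral_nonneg fun ω => abs_nonneg _
    have hX0 : 0 ≤ ∫ ω, |⟪v ω, DX ω⟫ - ((σ ^ 2 : ℝ≥0) : ℝ)| ∂P :=
      integral_nonneg fun ω => abs_nonneg _
    rw [mul_right_comm, ← hK] at hb
    refine (ENNReal.ofReal_le_ofReal hb).trans ?_
    rw [ENNReal.ofReal_mul hK0, ENNReal.ofReal_add hX0 hsum0,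
      ENNReal.ofReal_sum_of_nonneg fun j _ => integral_nonneg fun ω => abs_nonneg _]
    refine mul_le_mul' (ENNReal.coe_le_coe.2 (by simp)) (add_le_add hvarX ?_)
    exact Finset.sum_le_sum fun j _ => SteinMalliavin.ofReal_integral_abs_le
      (SteinMalliavin.integrable_inner_of_memLp hX.memLp_integrand (hY j).memLp_deriv).1
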